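/- Let $(\mathcal Z,\nu)$ be a $\sigma$-finite measure space such that the real Hilbert space $\mathcal H=L^2(\mathcal Z,\nu)$ is separable. For $v,w\in\mathcal H$ let $v\otimes w$ be the operator $x\mapsto\langle v,x\rangle w$; operators carry the operator norm. **Errors.** Let $\{\varepsilon_i\}_{i\in\mathbb Z}$ be a centered, strictly stationary sequence of random variables with values in $\mathcal H$ and $\mathsf E\|\varepsilon_0\|^k<\infty$ for some $k>2$. Put $C_r=\mathsf E[\varepsilon_0\otimes\varepsilon_r]$ and assume $\sum_{r\in\mathbb Z}\|C_r\|<\infty$ and $C_\varepsilon:=\sum_{r\in\mathbb Z}C_r\neq0$. Assume that there is an orthonormal basis $(v_p)$ of $\mathcal H$ with $C_\varepsilon=\sum_p\lambda_p\,v_p\otimes v_p$ and $\sum_p\sum_{r\in\mathbb Z}|\mathsf{Cov}(\langle\varepsilon_0,v_p\rangle,\langle\varepsilon_r,v_p\rangle)|<\infty$. Assume moreover that the errors are $L^m$-decomposable: there are an i.i.d. sequence $\{\eta_i\}_{i\in\mathbb Z}$ in a measurable space $\mathcal S$, a measurable $f:\mathcal S^{\mathbb N}\to\mathcal H$ and numbers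 $\kappa>m>2$ with $\varepsilon_i=f(\eta_i,\eta_{i-1},\dots)$ a.s. for all $i$, $\mathsf E\|\varepsilon_0\|^m<\infty$ and $$\sum_{\ell=0}^\infty\big(\mathsf E\|\varepsilon_0-\varepsilon^*_{0,\ell}\|^m\big)^{1/\kappa}<\infty,\qquad \varepsilon^*_{i,\ell}=f(\eta_i,\dots,\eta_{i-\ell+1},\eta^*_{i-\ell},\eta^*_{i-\ell-1},\dots),$$ where $\{\eta^*_i\}$ is an independent copy of $\{\eta_i\}$; and assume $\lim_{\ell\to\infty}\ell\,\big(\mathsf E\|\varepsilon_0-\varepsilon^*_{0,\ell}\|^2\big)^{1/2}=0$. **Estimator.** Let $K:\mathbb R\to\mathbb R$ be symmetric and continuous with compact support, $|K|\le1$ and $K(0)=1$, and let $h_n\to\infty$ with $h_n/\sqrt n\to0$. For a sample $X_1,\dots,X_n$ in $\mathcal H$ with mean $\bar X_n$ put $$\hat C_n=\sum_{r=-n}^nK\Big(\frac r{h_n}\Big)\hat C_r,\qquad \hat C_r=\begin{cases}\frac1n\sum_{i=1}^{n-r}(X_i-\bar X_n)\otimes(X_{i+r}-\bar X_n),& r\ge0,\\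 \frac1n\sum_{i=1}^{n-|r|}(X_{i-r}-\bar X_n)\otimes(X_i-\bar X_n),& r<0.\end{cases}$$ Then: (a) Under the null hypothesis, i.e. $X_i=\mu_i+\varepsilon_i$ for $i=1,\dots,n$ with deterministic means $\mu_1=\dots=\mu_n\in\mathcal H$ (the common value may depend on $n$), $\|\hat C_n-C_\varepsilon\|=o_P(1)$ as $n\to\infty$. (b) Under the alternative $X_i=\mu+\Delta_n\,g(i/n)+\varepsilon_i$, $i=1,\dots,n$, where $\mu,\Delta_n\in\mathcal H$, $\sqrt n\,\|\Delta_n\|\to\infty$, and $g:[0,1]\to\mathbb R$ is non-constant, bounded, Riemann integrable, with $g(0)=0$ and piecewise continuous ($[0,1]$ can be partitioned into finitely many intervals of positive length on each of which $g$ is continuous), one has $\|\hat C_n\|=o_P(n\|\Delta_n\|^2)$ as $n\to\infty$. -/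

import Mathlib

open MeasureTheory ProbabilityTheory Filter Topology

noncomputable section

namespace FunctionalChange

/-! ### Stochastic order symbol -/

/-- `Z n = o_P(a n)` as `n → ∞`: for every `c > 0`, `P(|Z n| > c |a n|) → 0`. -/
def IsLittleOP {Ω : Type*} [MeasurableSpace Ω] (P : Measure Ω) (Z : ℕ → Ω → ℝ) (a : ℕ → ℝ) : Prop :=
  ∀ c : ℝ, 0 < c → Tendsto (fun n => P {ω | c * |a n| < |Z n ω|}) atTop (𝓝 0)

/-! ### Tensor products, lagged covariance operators and the kernel estimator -/

section Estimator

variable {H : Type*} [NormedAddCommGroup H] [InnerProductSpace ℝ H]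

/-- The operator `v ⊗ w`, acting by `(v ⊗ w) x = ⟨v, x⟩ w`. -/
def tensor (v w : H) : H →L[ℝ] H := (innerSL ℝ v).smulRight w

theorem tensor_apply (v w x : H) : tensor v w x = inner ℝ v x • w := rfl

/-- The mean of `X 1, …, X n`. -/
def sampleMean (n : ℕ) (X : ℕ → H) : H := (n : ℝ)⁻¹ • ∑ i ∈ Finset.Icc 1 n, X i

/-- The empirical lag-`r` covariance operator of the sample `X 1, …, X n` (for `|r| ≤ n`); in the
case `r < 0` the index `i - r` of the first factor is `i + |r|`. -/
def lagCov (n : ℕ) (X : ℕ → H) (r : ℤ) : H →L[ℝ] H :=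
  if 0 ≤ r then
    (n : ℝ)⁻¹ • ∑ i ∈ Finset.Icc 1 (n - r.natAbs),
      tensor (X i - sampleMean n X) (X (i + r.natAbs) - sampleMean n X)
  else
    (n : ℝ)⁻¹ • ∑ i ∈ Finset.Icc 1 (n - r.natAbs),
      tensor (X (i + r.natAbs) - sampleMean n X) (X i - sampleMean n X)

/-- The kernel estimator of the long-run covariance operator, with kernel `K` and bandwidth `b`,
from the sample `X 1, …, X n`. -/
def kernelEstimator (K : ℝ → ℝ) (b : ℝ) (n : ℕ) (X : ℕ → H) : H →L[ℝ] H :=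
  ∑ r ∈ Finset.Icc (-(n : ℤ)) (n : ℤ), K ((r : ℝ) / b) • lagCov n X r

/-- The signal plus noise model `X i = m i + ε i`. -/
def observation {Ω : Type*} (m : ℕ → H) (ε : ℤ → Ω → H) (ω : Ω) (i : ℕ) : H := m i + ε (i : ℤ) ω

/-- The null hypothesis for a sample of size `n`: the means `m 1, …, m n` are all equal. -/
def NullHypothesis (n : ℕ) (m : ℕ → H) : Prop :=
  ∀ i ∈ Finset.Icc 1 n, ∀ j ∈ Finset.Icc 1 n, m i = m j

/-- The means under the alternative, `m i = μ + g (i / n) Δ`. -/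
def alternativeMean (μ Δ : H) (g : ℝ → ℝ) (n : ℕ) (i : ℕ) : H := μ + g ((i : ℝ) / (n : ℝ)) • Δ

end Estimator

/-! ### The kernel, the bandwidth and the change function -/

/-- A symmetric, continuous kernel, bounded by `1`, with compact support and `K 0 = 1`. -/
structure IsKernel (K : ℝ → ℝ) : Prop where
  symm : ∀ x, K (-x) = K x
  continuous : Continuous K
  bounded : ∀ x, |K x| ≤ 1
  compactSupport : HasCompactSupport K
  at_zero : K 0 = 1

/-- `h n → ∞` and `h n / √n → 0`. -/
structure IsBandwidth (h : ℕ → ℝ) : Prop where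
  tendsto_atTop : Tendsto h atTop atTop
  tendsto_div_sqrt : Tendsto (fun n : ℕ => h n / Real.sqrt n) atTop (𝓝 0)

/-- The unit interval as a one-dimensional box. -/
def unitBox : BoxIntegral.Box (Fin 1) where
  lower := fun _ => 0
  upper := fun _ => 1
  lower_lt_upper := fun _ => zero_lt_one

/-- Riemann integrability on `[0, 1]`. -/
def RiemannIntegrable (g : ℝ → ℝ) : Prop :=
  BoxIntegral.Integrable unitBox BoxIntegral.IntegrationParams.Riemann
    (fun x : Fin 1 → ℝ => g (x 0)) BoxIntegral.BoxAdditiveMap.volume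

/-- `[0, 1]` can be partitioned into finitely many intervals of positive length on each of which
`g` is continuous. -/
def PiecewiseContinuous (g : ℝ → ℝ) : Prop :=
  ∃ 𝓘 : Set (Set ℝ), 𝓘.Finite ∧ 𝓘.PairwiseDisjoint id ∧ ⋃₀ 𝓘 = Set.Icc 0 1 ∧
    ∀ I ∈ 𝓘, I.OrdConnected ∧ I.Nontrivial ∧ ContinuousOn g I

/-- Admissible change functions; only the values of `g` on `[0, 1]` matter. -/
structure IsChangeFunction (g : ℝ → ℝ) : Prop where
  nonconstant : ∃ x ∈ Set.Icc (0 : ℝ) 1, ∃ y ∈ Set.Icc (0 : ℝ) 1, g x ≠ g y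
  bounded : ∃ B : ℝ, ∀ x ∈ Set.Icc (0 : ℝ) 1, |g x| ≤ B
  riemannIntegrable : RiemannIntegrable g
  piecewiseContinuous : PiecewiseContinuous g
  zero : g 0 = 0

/-! ### The error process -/

section Errors

variable {Ω : Type*} [MeasurableSpace Ω]
  {H : Type*} [NormedAddCommGroup H] [InnerProductSpace ℝ H]

/-- The lag-`r` covariance operator `C_r = E[ε_0 ⊗ ε_r]`. -/
def autoCov (P : Measure Ω) (ε : ℤ → Ω → H) (r : ℤ) : H →L[ℝ] H :=
  ∫ ω, tensor (ε 0 ω) (ε r ω) ∂P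

/-- The long-run covariance operator `C_ε = ∑_{r ∈ ℤ} C_r`. -/
def longRunCov (P : Measure Ω) (ε : ℤ → Ω → H) : H →L[ℝ] H := ∑' r : ℤ, autoCov P ε r

/-- Strict stationarity: the law of the process `(ε_i)_{i ∈ ℤ}` is invariant under time shifts. -/
def StrictlyStationary [MeasurableSpace H] (P : Measure Ω) (ε : ℤ → Ω → H) : Prop :=
  ∀ t : ℤ, IdentDistrib (fun ω (i : ℤ) => ε (i + t) ω) (fun ω (i : ℤ) => ε i ω) P P

/-- The standing assumption on the errors: a centered, strictly stationary sequence with a finite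
moment of some order `k > 2`, absolutely summable autocovariance operators, nonzero long-run
covariance operator, and an orthonormal basis `v` of eigenvectors of the latter for which the
autocovariances of the scores are absolutely summable. -/
structure ErrorAssumption [MeasurableSpace H] (P : Measure Ω) (ε : ℤ → Ω → H) : Prop where
  measurable : ∀ i, Measurable (ε i)
  stationary : StrictlyStationary P ε
  moment : ∃ k : ℝ, 2 < k ∧ ∀ i, MemLp (ε i) (ENNReal.ofReal k) P
  centered : ∀ i, ∫ ω, ε i ω ∂P = 0
  summable_autoCov : Summable fun r : ℤ => ‖autoCov P ε r‖
  longRunCov_ne_zero : longRunCov P ε ≠ 0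
  spectral : ∃ (ι : Type) (v : HilbertBasis ι ℝ H) (lam : ι → ℝ),
    HasSum (fun p => lam p • tensor (v p) (v p)) (longRunCov P ε) ∧
    Summable fun q : ι × ℤ =>
      |cov[fun ω => inner ℝ (ε 0 ω) (v q.1), fun ω => inner ℝ (ε q.2 ω) (v q.1); P]|

variable {S : Type*} [MeasurableSpace S]

/-- The sequence `(η_i)_{i ∈ ℤ}` is i.i.d. -/
structure IsIID (P : Measure Ω) (η : ℤ → Ω → S) : Prop where
  measurable : ∀ i, Measurable (η i)
  indep : iIndepFun η P
  identDistrib : ∀ i, IdentDistrib (η i) (η 0) P P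

/-- `ε*_{i,ℓ} = g(η_i, …, η_{i-ℓ+1}, η*_{i-ℓ}, η*_{i-ℓ-1}, …)`. The variables are realised on
`Ω × Ω`, which carries the product measure `P ⊗ P`: `η` is a function of the first coordinate, and
its independent copy `η*` is the same function of the second coordinate. -/
def coupledError (g : (ℕ → S) → H) (η : ℤ → Ω → S) (i : ℤ) (l : ℕ) (p : Ω × Ω) : H :=
  g fun k : ℕ => if k < l then η (i - k) p.1 else η (i - k) p.2

/-- The coupling moments `E ‖ε_0 - ε*_{0,ℓ}‖ ^ m`. -/
def couplingMoment (P : Measure Ω) (ε : ℤ → Ω → H) (g : (ℕ → S) → H) (η : ℤ → Ω → S)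
    (m : ℝ) (l : ℕ) : ℝ :=
  ∫ p : Ω × Ω, ‖ε 0 p.1 - coupledError g η 0 l p‖ ^ m ∂(P.prod P)

/-- `L^m`-decomposability (with exponents `κ > m > 2`) of `ε_i = g(η_i, η_{i-1}, …)`. -/
structure LmDecomposable [MeasurableSpace H] (P : Measure Ω) (ε : ℤ → Ω → H)
    (g : (ℕ → S) → H) (η : ℤ → Ω → S) (m κ : ℝ) : Prop where
  two_lt : 2 < m
  lt : m < κ
  iid : IsIID P η
  measurable : Measurable g
  eq_shift : ∀ i : ℤ, ∀ᵐ ω ∂P, ε i ω = g fun k : ℕ => η (i - k) ω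
  moment : MemLp (ε 0) (ENNReal.ofReal m) P
  summable : Summable fun l : ℕ => couplingMoment P ε g η m l ^ (1 / κ)

end Errors

end FunctionalChange

end

/-!
The estimator is consistent because every term in it is controlled by second moments once one
factor of each product has been replaced by an independent one.

Write `ε_j = f(η_j, η_{j-1}, …)`, let `y^l_j` be the conditional expectation of `ε_j` given the `l`
most recent innovations, and let `δ_l` be the coupling distance in mean square, which bounds
`‖ε_j - y^l_j‖` in `L²` by Jensen's inequality. Decomposability with `κ > m > 2` makes `δ`
summable, and the last hypothesis on the errors makes `l δ_l` bounded. The structure `ShortMemory`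
records what is used of this pair of processes, and `IsIID.shortMemory` provides it.

For a lag `r`, split `n⁻¹ ∑ ε_i ⊗ ε_{i+r}` into the sum of `ε_i ⊗ y^r_{i+r}` and a remainder of mean
norm at most `M δ_r`, where `M` is the `L²` norm of `ε_0`. The two factors `ε_i` and `y^r_{i+r}`
are independent and the second is centered, so the Hilbert–Schmidt norm of the sum (`norm_sum_tensor_sq_le`) can be computed without
fourth moments. For `i < j = i + t < i + r` the cross term `⟨ε_i, ε_j⟩ ⟨y^r_{i+r}, y^r_{j+r}⟩` loses
its mean when `y^r_{j+r}` is replaced by `y^t_{j+r}`, at a cost of order `δ_r + δ_t`; for `t ≥ r` it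
has mean zero. Summation over `t` gives a bound of order `n^{-1/2}`, uniform in `r`
(`ShortMemory.exists_integral_norm_lagProduct_le`). Hence the mean error at lag `r` is at most
`C n^{-1/2} + b_r` with `b` summable. For each fixed `r` it tends to zero, by the strong law of
large numbers applied to `y^l_i ⊗ y^l_{i+r}` along arithmetic progressions. Since only `O(h_n)` lags
carry weight and `h_n = o(√n)`, dominated convergence over the lags yields (a). Negative lags are
adjoints of positive ones, and centering at the sample mean costs `O(n^{-1/2})` per lag.

For (b), the signal changes each lagged covariance by `O(‖Δ_n‖² + ‖Δ_n‖ N_n)`, where `N_n` is the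
average norm of the errors; multiplied by `O(h_n)` lags this is of smaller order than `n ‖Δ_n‖²`,
and the contribution of the errors alone is bounded in probability by (a).
-/

noncomputable section

namespace FunctionalChange

/-! ### Tensor operators and elementary sums -/

section Deterministic

variable {H : Type*} [NormedAddCommGroup H] [InnerProductSpace ℝ H]

/-- The map `(v, w) ↦ v ⊗ w` as a continuous bilinear map. -/
def tensorL : H →L[ℝ] H →L[ℝ] (H →L[ℝ] H) :=
  (ContinuousLinearMap.smulRightL ℝ H H).comp (innerSL ℝ)

theorem tensorL_apply (v w : H) : tensorL v w = tensor v w := rfl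

theorem norm_tensor (v w : H) : ‖tensor v w‖ = ‖v‖ * ‖w‖ := by
  simp [tensor, ContinuousLinearMap.norm_smulRight_apply]

theorem continuous_tensor : Continuous fun p : H × H => tensor p.1 p.2 := by
  have : Continuous fun p : H × H => tensorL p.1 p.2 := by fun_prop
  exact this

theorem tensor_sub_left (v v' w : H) : tensor (v - v') w = tensor v w - tensor v' w := by
  simp [← tensorL_apply]

theorem tensor_sub_right (v w w' : H) : tensor v (w - w') = tensor v w - tensor v w' := by
  simp [← tensorL_apply]

theorem norm_tensor_sub_tensor_le (a b c d : H) :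
    ‖tensor a b - tensor c d‖ ≤ ‖a‖ * ‖b - d‖ + ‖a - c‖ * ‖d‖ := by
  have : tensor a b - tensor c d = tensor a (b - d) + tensor (a - c) d := by
    rw [tensor_sub_right, tensor_sub_left]; abel
  rw [this, ← norm_tensor, ← norm_tensor]
  exact norm_add_le _ _

/-- A sum of rank-one operators is bounded in operator norm by its Hilbert–Schmidt norm, the
latter written through Gram matrices. -/
theorem norm_sum_tensor_sq_le {ι : Type*} (s : Finset ι) (a b : ι → H) :
    ‖∑ i ∈ s, tensor (a i) (b i)‖ ^ 2
      ≤ ∑ i ∈ s, ∑ j ∈ s, inner ℝ (a i) (a j) * inner ℝ (b i) (b j) := by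
  set T := ∑ i ∈ s, tensor (a i) (b i)
  set D := ∑ i ∈ s, ∑ j ∈ s, inner ℝ (a i) (a j) * inner ℝ (b i) (b j)
  have gram : ∀ c : ι → H, 0 ≤ ∑ i ∈ s, ∑ j ∈ s, inner ℝ (c i) (c j) * inner ℝ (b i) (b j) := by
    intro c
    -- This is the squared norm of `∑ c_i ⊗ b_i` in the inner product space `H ⊗ H`.
    have h := real_inner_self_nonneg (F := TensorProduct ℝ H H)
      (x := ∑ i ∈ s, TensorProduct.tmul ℝ (c i) (b i))
    simp only [sum_inner, inner_sum, TensorProduct.inner_tmul] at h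
    rwa [Finset.sum_comm] at h
  have hD : 0 ≤ D := gram a
  have key : ∀ x : H, ‖T x‖ ^ 2 ≤ D * ‖x‖ ^ 2 := by
    intro x
    -- The vectors `‖x‖ a_i - ‖x‖⁻¹ ⟨x, a_i⟩ x` have Gram matrix
    -- `‖x‖² ⟨a_i, a_j⟩ - ⟨x, a_i⟩ ⟨x, a_j⟩`.
    rcases eq_or_ne x 0 with rfl | hx
    · simp
    have hx' : ‖x‖ ≠ 0 := norm_ne_zero_iff.2 hx
    have h := gram fun i => ‖x‖ • a i - (‖x‖⁻¹ * inner ℝ x (a i)) • x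
    have e : ∀ i j, inner ℝ (‖x‖ • a i - (‖x‖⁻¹ * inner ℝ x (a i)) • x)
        (‖x‖ • a j - (‖x‖⁻¹ * inner ℝ x (a j)) • x)
        = ‖x‖ ^ 2 * inner ℝ (a i) (a j) - inner ℝ (a i) x * inner ℝ (a j) x := by
      intro i j
      simp only [inner_sub_left, inner_sub_right, real_inner_smul_left, real_inner_smul_right,
        real_inner_self_eq_norm_sq, real_inner_comm x]
      field_simp
      ring
    have hT : ‖T x‖ ^ 2 = ∑ i ∈ s, ∑ j ∈ s,
        (inner ℝ (a i) x * inner ℝ (a j) x) * inner ℝ (b i) (b j) := by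
      have : T x = ∑ i ∈ s, inner ℝ (a i) x • b i := by
        simp [T, tensor_apply]
      rw [this, ← real_inner_self_eq_norm_sq, sum_inner]
      refine Finset.sum_congr rfl fun i _ => ?_
      rw [inner_sum]
      refine Finset.sum_congr rfl fun j _ => ?_
      rw [real_inner_smul_left, real_inner_smul_right]; ring
    have hD' : D * ‖x‖ ^ 2 = ∑ i ∈ s, ∑ j ∈ s,
        (‖x‖ ^ 2 * inner ℝ (a i) (a j)) * inner ℝ (b i) (b j) := by
      simp only [D, Finset.sum_mul]
      refine Finset.sum_congr rfl fun i _ => Finset.sum_congr rfl fun j _ => ?_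
      ring
    simp only [e, sub_mul, Finset.sum_sub_distrib] at h
    rw [hT, hD']
    linarith
  have hop : ‖T‖ ≤ Real.sqrt D := by
    refine T.opNorm_le_bound (Real.sqrt_nonneg _) fun x => ?_
    have := Real.sqrt_le_sqrt (key x)
    rwa [Real.sqrt_sq (norm_nonneg _), Real.sqrt_mul hD, Real.sqrt_sq (norm_nonneg _)] at this
  calc ‖T‖ ^ 2 ≤ Real.sqrt D ^ 2 := by gcongr
    _ = D := Real.sq_sqrt hD

theorem adjoint_tensor [CompleteSpace H] (v w : H) :
    ContinuousLinearMap.adjoint (tensor v w) = tensor w v := by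
  symm
  rw [ContinuousLinearMap.eq_adjoint_iff]
  intro x y
  simp only [tensor_apply, real_inner_smul_right, real_inner_comm]
  ring

end Deterministic

theorem sum_Icc_one_eq_sum_range {M : Type*} [AddCommMonoid M] (f : ℕ → M) (N : ℕ) :
    ∑ i ∈ Finset.Icc 1 N, f i = ∑ i ∈ Finset.range N, f (i + 1) := by
  induction N with
  | zero => simp
  | succ n ih => rw [Finset.sum_Icc_succ_top (by omega), ih, Finset.sum_range_succ]

/-- A symmetric array whose entries are bounded by summable functions of the distance to the
diagonal has total sum of the order of its size. -/
theorem sum_sum_range_le_of_offDiag (a : ℕ → ℕ → ℝ) (c : ℕ → ℝ) (A D : ℝ) (N : ℕ)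
    (symm : ∀ i j, a i j = a j i) (diag : ∀ i, a i i ≤ A)
    (off : ∀ i t, 0 < t → a i (i + t) ≤ c t)
    (hc : ∀ T, ∑ k ∈ Finset.range T, c (k + 1) ≤ D) :
    ∑ i ∈ Finset.range N, ∑ j ∈ Finset.range N, a i j ≤ N * (A + 2 * D) := by
  induction N with
  | zero => simp
  | succ N ih =>
    have h1 : ∑ i ∈ Finset.range N, a i N ≤ D := by
      rw [← Finset.sum_range_reflect]
      refine le_trans (Finset.sum_le_sum fun i hi => ?_) (hc N)
      have hi' := Finset.mem_range.1 hi
      have := off (N - 1 - i) (i + 1) (by omega)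
      rwa [show N - 1 - i + (i + 1) = N by omega] at this
    have h2 : ∑ i ∈ Finset.range N, a N i = ∑ i ∈ Finset.range N, a i N :=
      Finset.sum_congr rfl fun i _ => symm _ _
    simp only [Finset.sum_range_succ, Finset.sum_add_distrib]
    push_cast
    rw [h2]
    linarith [diag N]

/-! ### Second moments of processes with short memory -/

section Moments

variable {Ω : Type*} [MeasurableSpace Ω] {P : Measure Ω}
  {E F : Type*} [NormedAddCommGroup E] [NormedAddCommGroup F]

theorem integrable_norm_mul_norm {f : Ω → E} {g : Ω → F} (hf : MemLp f 2 P) (hg : MemLp g 2 P) :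
    Integrable (fun ω => ‖f ω‖ * ‖g ω‖) P :=
  hf.norm.integrable_mul hg.norm

theorem integrable_norm_sq {f : Ω → E} (hf : MemLp f 2 P) :
    Integrable (fun ω => ‖f ω‖ ^ 2) P := hf.integrable_norm_pow two_ne_zero

theorem integral_norm_mul_norm_le {f : Ω → E} {g : Ω → F} (hf : MemLp f 2 P) (hg : MemLp g 2 P)
    {a b : ℝ} (ha : 0 ≤ a) (hb : 0 ≤ b) (hfa : ∫ ω, ‖f ω‖ ^ 2 ∂P ≤ a ^ 2)
    (hgb : ∫ ω, ‖g ω‖ ^ 2 ∂P ≤ b ^ 2) : ∫ ω, ‖f ω‖ * ‖g ω‖ ∂P ≤ a * b := by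
  have h := integral_mul_norm_le_Lp_mul_Lq (μ := P) (f := fun ω => ‖f ω‖) (g := fun ω => ‖g ω‖)
    (p := 2) (q := 2) (Real.HolderConjugate.two_two) (by simpa using hf.norm)
    (by simpa using hg.norm)
  simp only [norm_norm, ← Real.sqrt_eq_rpow, Real.rpow_two] at h
  refine h.trans (mul_le_mul ?_ ?_ (Real.sqrt_nonneg _) ha)
  · rw [← Real.sqrt_sq ha]; exact Real.sqrt_le_sqrt hfa
  · rw [← Real.sqrt_sq hb]; exact Real.sqrt_le_sqrt hgb

theorem integral_norm_le_of_sq [IsProbabilityMeasure P] {f : Ω → E} (hf : MemLp f 2 P)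
    {a : ℝ} (ha : 0 ≤ a) (hfa : ∫ ω, ‖f ω‖ ^ 2 ∂P ≤ a ^ 2) : ∫ ω, ‖f ω‖ ∂P ≤ a := by
  have := integral_norm_mul_norm_le (P := P) (g := fun _ => (1 : ℝ)) hf (memLp_const 1) ha
    zero_le_one hfa (by simp)
  simpa using this

theorem integrable_tensor {H : Type*} [NormedAddCommGroup H] [InnerProductSpace ℝ H]
    {f g : Ω → H} (hf : MemLp f 2 P) (hg : MemLp g 2 P) :
    Integrable (fun ω => tensor (f ω) (g ω)) P :=
  (integrable_norm_mul_norm hf hg).mono' (continuous_tensor.comp_aestronglyMeasurable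
    (hf.1.prodMk hg.1)) (ae_of_all _ fun _ => (norm_tensor _ _).le)

end Moments

section ShortMemory

variable {Ω : Type*} [mΩ : MeasurableSpace Ω]
  {H : Type*} [NormedAddCommGroup H] [InnerProductSpace ℝ H] [MeasurableSpace H]

/-- A process `x` with short memory in mean square. The σ-algebra `F I` stands for the innovations
with index in `I`; `x j` depends on the innovations up to time `j`, and `y l j` is a centered
approximation of `x j` that depends only on the `l` most recent ones, with an error `δ l` in mean
square. Both processes are bounded by `M` in mean square. -/
structure ShortMemory (P : Measure Ω) (F : Set ℤ → MeasurableSpace Ω) (x : ℤ → Ω → H)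
    (y : ℕ → ℤ → Ω → H) (M : ℝ) (δ : ℕ → ℝ) : Prop where
  le : ∀ I, F I ≤ mΩ
  mono : Monotone F
  indep : ∀ I J, Disjoint I J → Indep (F I) (F J) P
  measurable_x : ∀ j, Measurable[F (Set.Iic j)] (x j)
  measurable_y : ∀ (l : ℕ) j, Measurable[F (Set.Ioc (j - l) j)] (y l j)
  memLp_x : ∀ j, MemLp (x j) 2 P
  memLp_y : ∀ l j, MemLp (y l j) 2 P
  nonneg : 0 ≤ M
  sq_x : ∀ j, ∫ ω, ‖x j ω‖ ^ 2 ∂P ≤ M ^ 2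
  sq_y : ∀ l j, ∫ ω, ‖y l j ω‖ ^ 2 ∂P ≤ M ^ 2
  mean_y : ∀ l j, ∫ ω, y l j ω ∂P = 0
  err_nonneg : ∀ l, 0 ≤ δ l
  err : ∀ l j, ∫ ω, ‖x j ω - y l j ω‖ ^ 2 ∂P ≤ δ l ^ 2
  summable : Summable δ
  bounded : ∃ B, ∀ l : ℕ, l * δ l ≤ B
  identDistrib_x : ∀ (r : ℕ) (j : ℤ), IdentDistrib (fun ω => (x j ω, x (j + r) ω))
    (fun ω => (x 0 ω, x r ω)) P P
  identDistrib_y : ∀ (l r : ℕ) (j : ℤ), IdentDistrib (fun ω => (y l j ω, y l (j + r) ω))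
    (fun ω => (y l 0 ω, y l r ω)) P P

namespace ShortMemory

variable {P : Measure Ω} {F : Set ℤ → MeasurableSpace Ω} {x : ℤ → Ω → H}
    {y : ℕ → ℤ → Ω → H} {M : ℝ} {δ : ℕ → ℝ}

theorem indepFun (hs : ShortMemory P F x y M δ) {α β : Type*} [MeasurableSpace α]
    [MeasurableSpace β] {I J : Set ℤ} (hIJ : Disjoint I J) {f : Ω → α} {g : Ω → β}
    (hf : Measurable[F I] f) (hg : Measurable[F J] g) : IndepFun f g P := by
  rw [IndepFun_iff_Indep]
  exact indep_of_indep_of_le_left (indep_of_indep_of_le_right (hs.indep I J hIJ) hg.comap_le)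
    hf.comap_le

theorem integral_inner_eq_zero [CompleteSpace H] [BorelSpace H] (hs : ShortMemory P F x y M δ)
    {I J : Set ℤ} (hIJ : Disjoint I J) {f g : Ω → H} (hf : Measurable[F I] f)
    (hg : Measurable[F J] g) (hfi : Integrable f P) (hgi : Integrable g P)
    (hg0 : ∫ ω, g ω ∂P = 0) : ∫ ω, inner ℝ (f ω) (g ω) ∂P = 0 := by
  have := (hs.indepFun hIJ hf hg).integral_bilin hfi hgi (innerSL ℝ)
  rw [hg0, map_zero] at this
  exact this

theorem memLp_norm_mul_norm [OpensMeasurableSpace H] (hs : ShortMemory P F x y M δ)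
    {I J : Set ℤ} (hIJ : Disjoint I J) {f g : Ω → H} (hf : Measurable[F I] f)
    (hg : Measurable[F J] g) (hfi : MemLp f 2 P) (hgi : MemLp g 2 P) :
    MemLp (fun ω => ‖f ω‖ * ‖g ω‖) 2 P := by
  have hi := (hs.indepFun hIJ hf hg).comp (φ := fun v => ‖v‖ ^ 2) (ψ := fun v => ‖v‖ ^ 2)
    (by fun_prop) (by fun_prop)
  have := hi.integrable_mul (integrable_norm_sq hfi) (integrable_norm_sq hgi)
  refine (memLp_two_iff_integrable_sq (hfi.1.norm.mul hgi.1.norm)).2 ?_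
  refine this.congr (ae_of_all _ fun ω => ?_)
  simp [mul_pow]

theorem integral_norm_mul_norm_sq_le [OpensMeasurableSpace H] (hs : ShortMemory P F x y M δ)
    {I J : Set ℤ} (hIJ : Disjoint I J) {f g : Ω → H} (hf : Measurable[F I] f)
    (hg : Measurable[F J] g) (hfi : MemLp f 2 P) (hgi : MemLp g 2 P) {a b : ℝ}
    (hfa : ∫ ω, ‖f ω‖ ^ 2 ∂P ≤ a ^ 2) (hgb : ∫ ω, ‖g ω‖ ^ 2 ∂P ≤ b ^ 2) :
    ∫ ω, ‖‖f ω‖ * ‖g ω‖‖ ^ 2 ∂P ≤ (a * b) ^ 2 := by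
  have hi := (hs.indepFun hIJ hf hg).comp (φ := fun v => ‖v‖ ^ 2) (ψ := fun v => ‖v‖ ^ 2)
    (by fun_prop) (by fun_prop)
  have := hi.integral_fun_mul_eq_mul_integral (hfi.1.norm.pow 2) (hgi.1.norm.pow 2)
  simp only [Function.comp_def] at this
  simp only [norm_mul, norm_norm, mul_pow]
  rw [this]
  exact mul_le_mul hfa hgb (integral_nonneg fun _ => by positivity) (by positivity)

variable (hs : ShortMemory P F x y M δ)
include hs

theorem memLp_sub (l : ℕ) (j : ℤ) : MemLp (fun ω => x j ω - y l j ω) 2 P :=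
  (hs.memLp_x j).sub (hs.memLp_y l j)

theorem integrable_y [IsFiniteMeasure P] (l : ℕ) (j : ℤ) : Integrable (y l j) P :=
  (hs.memLp_y l j).integrable one_le_two

theorem integrable_x [IsFiniteMeasure P] (j : ℤ) : Integrable (x j) P :=
  (hs.memLp_x j).integrable one_le_two

theorem integral_norm_y_sub_y_sq_le (l l' : ℕ) (j : ℤ) :
    ∫ ω, ‖y l j ω - y l' j ω‖ ^ 2 ∂P ≤ (2 * (δ l + δ l')) ^ 2 := by
  have h1 := integrable_norm_sq (hs.memLp_sub l j)
  have h2 := integrable_norm_sq (hs.memLp_sub l' j)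
  have h3 : ∫ ω, ‖y l j ω - y l' j ω‖ ^ 2 ∂P
      ≤ ∫ ω, (2 * ‖x j ω - y l j ω‖ ^ 2 + 2 * ‖x j ω - y l' j ω‖ ^ 2) ∂P := by
    refine integral_mono (integrable_norm_sq ((hs.memLp_y l j).sub (hs.memLp_y l' j)))
      ((h1.const_mul 2).add (h2.const_mul 2)) fun ω => ?_
    have : y l j ω - y l' j ω = (x j ω - y l' j ω) - (x j ω - y l j ω) := by abel
    have h4 := norm_sub_le (x j ω - y l' j ω) (x j ω - y l j ω)
    simp only
    rw [this]
    nlinarith [norm_nonneg ((x j ω - y l' j ω) - (x j ω - y l j ω)),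
      sq_nonneg (‖x j ω - y l' j ω‖ - ‖x j ω - y l j ω‖)]
  rw [integral_add (h1.const_mul 2) (h2.const_mul 2), integral_const_mul, integral_const_mul] at h3
  nlinarith [hs.err l j, hs.err l' j, hs.err_nonneg l, hs.err_nonneg l',
    mul_nonneg (hs.err_nonneg l) (hs.err_nonneg l')]

variable [IsProbabilityMeasure P] [CompleteSpace H] [BorelSpace H]

theorem integral_inner_x_le (j : ℤ) (t : ℕ) :
    ∫ ω, inner ℝ (x j ω) (x (j + t) ω) ∂P ≤ M * δ t := by
  have h0 : ∫ ω, inner ℝ (x j ω) (y t (j + t) ω) ∂P = 0 :=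
    hs.integral_inner_eq_zero (Set.disjoint_left.2 fun k hk hk' => by
      simp only [Set.mem_Iic, Set.mem_Ioc] at hk hk'; omega)
      (hs.measurable_x j) (hs.measurable_y t (j + t)) (hs.integrable_x j)
      (hs.integrable_y t _) (hs.mean_y t _)
  have e : ∀ ω, inner ℝ (x j ω) (x (j + t) ω)
      = inner ℝ (x j ω) (x (j + t) ω - y t (j + t) ω) + inner ℝ (x j ω) (y t (j + t) ω) := by
    intro ω; rw [← inner_add_right]; simp
  have hi1 : Integrable (fun ω => inner ℝ (x j ω) (x (j + t) ω - y t (j + t) ω)) P :=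
    (integrable_norm_mul_norm (hs.memLp_x j) (hs.memLp_sub t (j + t))).mono'
      ((hs.memLp_x j).1.inner (hs.memLp_sub t (j + t)).1)
      (ae_of_all _ fun ω => norm_inner_le_norm _ _)
  have hi2 : Integrable (fun ω => inner ℝ (x j ω) (y t (j + t) ω)) P :=
    (integrable_norm_mul_norm (hs.memLp_x j) (hs.memLp_y t (j + t))).mono'
      ((hs.memLp_x j).1.inner (hs.memLp_y t (j + t)).1)
      (ae_of_all _ fun ω => norm_inner_le_norm _ _)
  simp only [e]
  rw [integral_add hi1 hi2, h0, add_zero]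
  refine (integral_mono hi1 (integrable_norm_mul_norm (hs.memLp_x j) (hs.memLp_sub t (j + t)))
    fun ω => real_inner_le_norm _ _).trans ?_
  exact integral_norm_mul_norm_le (hs.memLp_x j) (hs.memLp_sub t (j + t)) hs.nonneg
    (hs.err_nonneg t) (hs.sq_x j) (hs.err t _)

/-- The partial sums of a short-memory process are of the order of the square root of their
length. -/
theorem integral_norm_sum_x_sq_le (n : ℕ) :
    ∫ ω, ‖∑ i ∈ Finset.Icc 1 n, x (i : ℤ) ω‖ ^ 2 ∂P ≤ n * (M ^ 2 + 2 * (M * ∑' l, δ l)) := by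
  have hi : ∀ i j : ℕ, Integrable
      (fun ω => inner ℝ (x ((i + 1 : ℕ) : ℤ) ω) (x ((j + 1 : ℕ) : ℤ) ω)) P := fun i j =>
    (integrable_norm_mul_norm (hs.memLp_x _) (hs.memLp_x _)).mono'
      ((hs.memLp_x _).1.inner (hs.memLp_x _).1) (ae_of_all _ fun ω => norm_inner_le_norm _ _)
  have e : ∫ ω, ‖∑ i ∈ Finset.Icc 1 n, x (i : ℤ) ω‖ ^ 2 ∂P
      = ∑ i ∈ Finset.range n, ∑ j ∈ Finset.range n,
        ∫ ω, inner ℝ (x ((i + 1 : ℕ) : ℤ) ω) (x ((j + 1 : ℕ) : ℤ) ω) ∂P := by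
    have : ∀ ω, ‖∑ i ∈ Finset.Icc 1 n, x (i : ℤ) ω‖ ^ 2
        = ∑ i ∈ Finset.range n, ∑ j ∈ Finset.range n,
          inner ℝ (x ((i + 1 : ℕ) : ℤ) ω) (x ((j + 1 : ℕ) : ℤ) ω) := by
      intro ω
      rw [sum_Icc_one_eq_sum_range (fun i => x (i : ℤ) ω), ← real_inner_self_eq_norm_sq,
        sum_inner]
      exact Finset.sum_congr rfl fun i _ => inner_sum _ _ _
    simp only [this]
    rw [integral_finsetSum _ fun i _ => integrable_finsetSum _ fun j _ => hi i j]
    exact Finset.sum_congr rfl fun i _ => integral_finsetSum _ fun j _ => hi i j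
  rw [e]
  refine sum_sum_range_le_of_offDiag _ (fun t => M * δ t) _ _ n (fun i j => ?_) (fun i => ?_)
    (fun i t _ => ?_) fun T => ?_
  · simp only [real_inner_comm]
  · simpa only [real_inner_self_eq_norm_sq] using hs.sq_x _
  · have := hs.integral_inner_x_le ((i + 1 : ℕ) : ℤ) t
    convert this using 6
    push_cast; ring
  · rw [← Finset.mul_sum]
    refine mul_le_mul_of_nonneg_left ?_ hs.nonneg
    have h1 := Finset.sum_range_succ' δ T
    have h2 := hs.summable.sum_le_tsum (Finset.range (T + 1)) fun i _ => hs.err_nonneg i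
    linarith [hs.err_nonneg 0]

variable [SecondCountableTopology H]

/-- Fourth-order cross moments of the summands `x_j ⊗ y_{j + r}`, at two times that are `t`
apart. When `t < r`, the last factor is replaced by one that depends only on the `t` most recent
innovations, which are independent of the other three factors. Second moments suffice because the
two factors of each summand are independent. -/
theorem integral_inner_mul_inner_le (j : ℤ) (r t : ℕ) (ht : 0 < t) :
    ∫ ω, inner ℝ (x j ω) (x (j + t) ω) * inner ℝ (y r (j + r) ω) (y r (j + t + r) ω) ∂P
      ≤ if t < r then M ^ 3 * (2 * (δ r + δ t)) else 0 := by
  have hd : ∀ (i : ℤ) (u : ℕ), Disjoint (Set.Iic i) (Set.Ioc (i + u - u) (i + u)) := fun i u =>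
    Set.disjoint_left.2 fun k hk hk' => by
      simp only [Set.mem_Iic, Set.mem_Ioc] at hk hk'; omega
  have hZ : MemLp (fun ω => ‖x j ω‖ * ‖y r (j + r) ω‖) 2 P :=
    hs.memLp_norm_mul_norm (hd j r) (hs.measurable_x j) (hs.measurable_y r _) (hs.memLp_x j)
      (hs.memLp_y r _)
  have hZ2 := hs.integral_norm_mul_norm_sq_le (hd j r) (hs.measurable_x j) (hs.measurable_y r _)
    (hs.memLp_x j) (hs.memLp_y r _) (hs.sq_x j) (hs.sq_y r _)
  set W : Ω → H := fun ω => inner ℝ (x j ω) (x (j + t) ω) • y r (j + r) ω with hW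
  have hWle : ∀ ω, ‖W ω‖ ≤ ‖‖x j ω‖ * ‖y r (j + r) ω‖‖ * ‖x (j + t) ω‖ := fun ω => by
    rw [hW, norm_smul, norm_mul, norm_norm, norm_norm]
    have := norm_inner_le_norm (𝕜 := ℝ) (x j ω) (x (j + t) ω)
    calc _ ≤ (‖x j ω‖ * ‖x (j + t) ω‖) * ‖y r (j + r) ω‖ := by gcongr
      _ = _ := by ring
  have hWm : AEStronglyMeasurable W P :=
    ((hs.memLp_x j).1.inner (hs.memLp_x (j + t)).1).smul (hs.memLp_y r (j + r)).1
  have hWi : Integrable W P :=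
    (integrable_norm_mul_norm hZ (hs.memLp_x (j + t))).mono' hWm (ae_of_all _ hWle)
  have e : ∀ ω, inner ℝ (x j ω) (x (j + t) ω) * inner ℝ (y r (j + r) ω) (y r (j + t + r) ω)
      = inner ℝ (W ω) (y r (j + t + r) ω) := fun ω => by rw [real_inner_smul_left]
  simp only [e]
  have hmeasW : ∀ i : ℤ, j + t ≤ i → j + r ≤ i → Measurable[F (Set.Iic i)] W := by
    intro i h1 h2
    have m1 : Measurable[F (Set.Iic i)] (x j) :=
      (hs.measurable_x j).mono (hs.mono (Set.Iic_subset_Iic.2 (by omega))) le_rfl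
    have m2 : Measurable[F (Set.Iic i)] (x (j + t)) :=
      (hs.measurable_x _).mono (hs.mono (Set.Iic_subset_Iic.2 (by omega))) le_rfl
    have m3 : Measurable[F (Set.Iic i)] (y r (j + r)) :=
      (hs.measurable_y r _).mono (hs.mono fun k hk => by
        simp only [Set.mem_Iic, Set.mem_Ioc] at hk ⊢; omega) le_rfl
    exact (m1.inner m2).smul m3
  split_ifs with htr
  · have h0 : ∫ ω, inner ℝ (W ω) (y t (j + r + t) ω) ∂P = 0 :=
      hs.integral_inner_eq_zero (hd _ _) (hmeasW (j + r) (by omega) le_rfl)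
        (hs.measurable_y t _) hWi (hs.integrable_y t _) (hs.mean_y t _)
    have hdiff : MemLp (fun ω => y r (j + t + r) ω - y t (j + t + r) ω) 2 P :=
      (hs.memLp_y r _).sub (hs.memLp_y t _)
    have hdiffm : Measurable[F (Set.Ioc (j + t + r - r) (j + t + r))]
        (fun ω => y r (j + t + r) ω - y t (j + t + r) ω) := by
      have m1 := hs.measurable_y r (j + t + r)
      have m2 : Measurable[F (Set.Ioc (j + t + r - r) (j + t + r))] (y t (j + t + r)) :=
        (hs.measurable_y t _).mono (hs.mono fun k hk => by
          simp only [Set.mem_Ioc] at hk ⊢; omega) le_rfl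
      exact m1.sub m2
    have hD : Disjoint (Set.Iic (j + t)) (Set.Ioc (j + t + r - r) (j + t + r)) := hd _ _
    have hZ' := hs.memLp_norm_mul_norm hD (hs.measurable_x (j + t)) hdiffm (hs.memLp_x _) hdiff
    have hZ2' := hs.integral_norm_mul_norm_sq_le hD (hs.measurable_x (j + t)) hdiffm
      (hs.memLp_x _) hdiff (hs.sq_x _) (hs.integral_norm_y_sub_y_sq_le r t _)
    have e2 : ∀ ω, inner ℝ (W ω) (y r (j + t + r) ω)
        = inner ℝ (W ω) (y r (j + t + r) ω - y t (j + t + r) ω)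
          + inner ℝ (W ω) (y t (j + r + t) ω) := by
      intro ω
      rw [← inner_add_right, show j + (r : ℤ) + t = j + t + r by ring, sub_add_cancel]
    have hle : ∀ ω, ‖(inner ℝ (W ω) (y r (j + t + r) ω - y t (j + t + r) ω) : ℝ)‖
        ≤ ‖‖x j ω‖ * ‖y r (j + r) ω‖‖
          * ‖‖x (j + t) ω‖ * ‖y r (j + t + r) ω - y t (j + t + r) ω‖‖ := fun ω => by
      refine (norm_inner_le_norm _ _).trans ?_
      rw [norm_mul ‖x (j + t) ω‖, norm_norm (x (j + t) ω), norm_norm (_ - _), ← mul_assoc]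
      gcongr
      exact hWle ω
    have hi1 : Integrable
        (fun ω => (inner ℝ (W ω) (y r (j + t + r) ω - y t (j + t + r) ω) : ℝ)) P :=
      (integrable_norm_mul_norm hZ hZ').mono' (hWm.inner hdiff.1) (ae_of_all _ hle)
    have hi2 : Integrable (fun ω => (inner ℝ (W ω) (y t (j + r + t) ω) : ℝ)) P :=
      (hs.indepFun (hd (j + r) t) (hmeasW (j + r) (by omega) le_rfl)
        (hs.measurable_y t _)).integrable_bilin hWi (hs.integrable_y t _) (innerSL ℝ)
    simp only [e2]
    rw [integral_add hi1 hi2, h0, add_zero]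
    refine (integral_mono hi1 (integrable_norm_mul_norm hZ hZ')
      fun ω => (le_abs_self _).trans (hle ω)).trans ?_
    refine (integral_norm_mul_norm_le hZ hZ' (mul_nonneg hs.nonneg hs.nonneg)
      (mul_nonneg hs.nonneg ?_) hZ2 hZ2').trans (le_of_eq (by ring))
    linarith [hs.err_nonneg r, hs.err_nonneg t]
  · refine le_of_eq (hs.integral_inner_eq_zero (hd (j + t) r)
      (hmeasW _ le_rfl (by omega)) (hs.measurable_y r _) hWi (hs.integrable_y r _)
      (hs.mean_y r _))

/-- The sums `∑ x_i ⊗ y_{i + r}` are of the order of the square root of their length, uniformly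
in `r`. -/
theorem exists_integral_norm_sum_tensor_sq_le :
    ∃ C, 0 ≤ C ∧ ∀ n r : ℕ,
      ∫ ω, ‖∑ i ∈ Finset.Icc 1 n, tensor (x (i : ℤ) ω) (y r (i + r) ω)‖ ^ 2 ∂P ≤ n * C := by
  obtain ⟨B, hB⟩ := hs.bounded
  have hS : 0 ≤ ∑' l, δ l := tsum_nonneg hs.err_nonneg
  have hB0 : 0 ≤ B := by simpa using hB 0
  refine ⟨(M * M) ^ 2 + 2 * (M ^ 3 * 2 * (B + ∑' l, δ l)), ?_, fun n r => ?_⟩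
  · have := hs.nonneg
    positivity
  have hd : ∀ (i : ℤ) (u : ℕ), Disjoint (Set.Iic i) (Set.Ioc (i + u - u) (i + u)) := fun i u =>
    Set.disjoint_left.2 fun k hk hk' => by
      simp only [Set.mem_Iic, Set.mem_Ioc] at hk hk'; omega
  have hZ : ∀ j : ℤ, MemLp (fun ω => ‖x j ω‖ * ‖y r (j + r) ω‖) 2 P := fun j =>
    hs.memLp_norm_mul_norm (hd j r) (hs.measurable_x j) (hs.measurable_y r _) (hs.memLp_x j)
      (hs.memLp_y r _)
  have hZ2 := fun j : ℤ => hs.integral_norm_mul_norm_sq_le (hd j r) (hs.measurable_x j)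
    (hs.measurable_y r _) (hs.memLp_x j) (hs.memLp_y r _) (hs.sq_x j) (hs.sq_y r _)
  have hi : ∀ i j : ℤ, Integrable
      (fun ω => inner ℝ (x i ω) (x j ω) * inner ℝ (y r (i + r) ω) (y r (j + r) ω)) P := by
    intro i j
    refine (integrable_norm_mul_norm (hZ i) (hZ j)).mono'
      (((hs.memLp_x i).1.inner (hs.memLp_x j).1).mul
        ((hs.memLp_y r _).1.inner (hs.memLp_y r _).1)) (ae_of_all _ fun ω => ?_)
    simp only [norm_mul, norm_norm]
    calc _ ≤ (‖x i ω‖ * ‖x j ω‖) * (‖y r (i + r) ω‖ * ‖y r (j + r) ω‖) := by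
          gcongr <;> exact norm_inner_le_norm _ _
      _ = _ := by ring
  set a : ℕ → ℕ → ℝ := fun i j =>
    ∫ ω, inner ℝ (x ((i + 1 : ℕ) : ℤ) ω) (x ((j + 1 : ℕ) : ℤ) ω)
      * inner ℝ (y r ((i + 1 : ℕ) + r) ω) (y r ((j + 1 : ℕ) + r) ω) ∂P with ha
  have e : ∫ ω, ‖∑ i ∈ Finset.Icc 1 n, tensor (x (i : ℤ) ω) (y r (i + r) ω)‖ ^ 2 ∂P
      ≤ ∑ i ∈ Finset.range n, ∑ j ∈ Finset.range n, a i j := by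
    have h1 : ∑ i ∈ Finset.range n, ∑ j ∈ Finset.range n, a i j
        = ∫ ω, ∑ i ∈ Finset.range n, ∑ j ∈ Finset.range n,
          inner ℝ (x ((i + 1 : ℕ) : ℤ) ω) (x ((j + 1 : ℕ) : ℤ) ω)
          * inner ℝ (y r ((i + 1 : ℕ) + r) ω) (y r ((j + 1 : ℕ) + r) ω) ∂P := by
      rw [integral_finsetSum _ fun i _ => integrable_finsetSum _ fun j _ => hi _ _]
      exact Finset.sum_congr rfl fun i _ => (integral_finsetSum _ fun j _ => hi _ _).symm
    rw [h1]
    refine integral_mono_of_nonneg (ae_of_all _ fun ω => by positivity)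
      (integrable_finsetSum _ fun i _ => integrable_finsetSum _ fun j _ => hi _ _)
      (ae_of_all _ fun ω => ?_)
    simp only
    rw [sum_Icc_one_eq_sum_range (fun i => tensor (x (i : ℤ) ω) (y r (i + r) ω))]
    exact norm_sum_tensor_sq_le _ _ _
  refine e.trans (sum_sum_range_le_of_offDiag a
    (fun t => if t < r then M ^ 3 * (2 * (δ r + δ t)) else 0) _ _ n (fun i j => ?_) (fun i => ?_)
    (fun i t ht => ?_) fun T => ?_)
  · simp only [ha, real_inner_comm]
  · refine le_trans (le_of_eq (integral_congr_ae (ae_of_all _ fun ω => ?_))) (hZ2 (i + 1 : ℕ))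
    simp [mul_pow]
  · have := hs.integral_inner_mul_inner_le ((i + 1 : ℕ) : ℤ) r t ht
    simp only [ha]
    rwa [show ((i + t + 1 : ℕ) : ℤ) = ((i + 1 : ℕ) : ℤ) + t by push_cast; ring]
  · have hM3 : 0 ≤ M ^ 3 * 2 := by have := hs.nonneg; positivity
    have h1 := Finset.sum_range_succ' δ T
    have h2 := hs.summable.sum_le_tsum (Finset.range (T + 1)) fun i _ => hs.err_nonneg i
    have h3 : ∑ k ∈ Finset.range T, (if k < r then δ r else 0) ≤ r * δ r := by
      rw [← Finset.sum_filter, Finset.sum_const, nsmul_eq_mul]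
      gcongr
      · exact hs.err_nonneg r
      · calc _ ≤ (Finset.range r).card := Finset.card_le_card fun k hk => by
              simp only [Finset.mem_filter, Finset.mem_range] at hk ⊢; exact hk.2
          _ = r := Finset.card_range r
    calc ∑ k ∈ Finset.range T, (if k + 1 < r then M ^ 3 * (2 * (δ r + δ (k + 1))) else 0)
        ≤ ∑ k ∈ Finset.range T, M ^ 3 * 2 * ((if k < r then δ r else 0) + δ (k + 1)) := by
          refine Finset.sum_le_sum fun k _ => ?_
          have h4 := mul_nonneg hM3 (hs.err_nonneg r)
          have h5 := mul_nonneg hM3 (hs.err_nonneg (k + 1))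
          split_ifs with h6 h7
          · exact le_of_eq (by ring)
          · omega
          · rw [mul_add]; exact add_nonneg h4 h5
          · rw [zero_add]; exact h5
      _ = M ^ 3 * 2 * (∑ k ∈ Finset.range T, (if k < r then δ r else 0)
          + ∑ k ∈ Finset.range T, δ (k + 1)) := by
          rw [← Finset.mul_sum, Finset.sum_add_distrib]
      _ ≤ M ^ 3 * 2 * (B + ∑' l, δ l) := by
          refine mul_le_mul_of_nonneg_left ?_ hM3
          linarith [hB r, hs.err_nonneg 0]

end ShortMemory

end ShortMemory

/-! ### Laws of large numbers for lagged products -/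

theorem sum_range_mul_add {M : Type*} [AddCommMonoid M] (f : ℕ → M) (L q s : ℕ) :
    ∑ i ∈ Finset.range (L * q + s), f i
      = ∑ a ∈ Finset.range L, ∑ b ∈ Finset.range q, f (L * b + a)
        + ∑ a ∈ Finset.range s, f (L * q + a) := by
  rw [Finset.sum_range_add]
  congr 1
  induction q with
  | zero => simp
  | succ q ih =>
    rw [Nat.mul_succ, Finset.sum_range_add, ih, ← Finset.sum_add_distrib]
    exact Finset.sum_congr rfl fun a _ => (Finset.sum_range_succ _ _).symm

/-- The law of large numbers in mean for identically distributed variables that are independent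
when their indices are at least `L` apart. -/
theorem tendsto_integral_norm_average_sub {Ω : Type*} [MeasurableSpace Ω] {P : Measure Ω}
    [IsProbabilityMeasure P] {G : Type*} [NormedAddCommGroup G] [NormedSpace ℝ G]
    [CompleteSpace G] [MeasurableSpace G] [BorelSpace G] (Z : ℕ → Ω → G) (L : ℕ) (hL : 0 < L)
    (hint : Integrable (Z 0) P) (hindep : ∀ i j, i + L ≤ j → IndepFun (Z i) (Z j) P)
    (hident : ∀ i, IdentDistrib (Z i) (Z 0) P P) :
    Tendsto (fun n : ℕ => ∫ ω, ‖(n : ℝ)⁻¹ • (∑ i ∈ Finset.range n, Z i ω) - P[Z 0]‖ ∂P)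
      atTop (𝓝 0) := by
  have hint' : ∀ i, Integrable (Z i) P := fun i => (hident i).integrable_iff.2 hint
  have hmean : ∀ i, P[Z i] = P[Z 0] := fun i => (hident i).integral_eq
  set μ := P[Z 0] with hμ
  set c := ∫ ω, ‖Z 0 ω - μ‖ ∂P with hc
  have hcen : ∀ i, ∫ ω, ‖Z i ω - μ‖ ∂P = c := fun i =>
    ((hident i).comp (u := fun z => ‖z - μ‖) (by fun_prop)).integral_eq
  have hci : ∀ i, Integrable (fun ω => Z i ω - μ) P := fun i =>
    (hint' i).sub (integrable_const _)
  set V : ℕ → ℕ → ℝ := fun a q =>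
    ∫ ω, ‖(q : ℝ)⁻¹ • (∑ b ∈ Finset.range q, Z (L * b + a) ω) - μ‖ ∂P with hV
  have hVlim : ∀ a, Tendsto (V a) atTop (𝓝 0) := by
    intro a
    have h := strong_law_Lp (μ := P) le_rfl ENNReal.one_ne_top (fun b => Z (L * b + a))
      (memLp_one_iff_integrable.2 (hint' _)) (fun b b' hb => by
        have key : ∀ u v, u < v → IndepFun (Z (L * u + a)) (Z (L * v + a)) P := fun u v huv =>
          hindep _ _ (by nlinarith [Nat.mul_le_mul_left L (Nat.succ_le_of_lt huv)])
        rcases lt_or_gt_of_ne hb with h | h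
        · exact key _ _ h
        · exact (key _ _ h).symm) (fun b => (hident _).trans (hident _).symm)
    rw [hmean] at h
    have h2 := (ENNReal.tendsto_toReal ENNReal.zero_ne_top).comp h
    refine (by simpa using h2 : Tendsto _ _ (𝓝 (0 : ℝ))).congr fun q => ?_
    have hm : Integrable
        (fun ω => (q : ℝ)⁻¹ • (∑ b ∈ Finset.range q, Z (L * b + a) ω) - μ) P :=
      ((integrable_finsetSum _ fun b _ => hint' _).smul _).sub (integrable_const _)
    simp only [hV, Function.comp_apply]
    rw [integral_norm_eq_lintegral_enorm hm.1, eLpNorm_one_eq_lintegral_enorm]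
  have hbound : ∀ n : ℕ, 0 < n →
      ∫ ω, ‖(n : ℝ)⁻¹ • (∑ i ∈ Finset.range n, Z i ω) - μ‖ ∂P
        ≤ ∑ a ∈ Finset.range L, V a (n / L) + (n : ℝ)⁻¹ * (L * c) := by
    intro n hn
    have hn' : (n : ℝ) ≠ 0 := by positivity
    set q := n / L
    set s := n % L
    have hqs : L * q + s = n := Nat.div_add_mod n L
    have hi1 : ∀ a, Integrable
        (fun ω => ‖(q : ℝ)⁻¹ • (∑ b ∈ Finset.range q, Z (L * b + a) ω) - μ‖) P := fun a =>
      (((integrable_finsetSum _ fun b _ => hint' _).smul _).sub (integrable_const _)).norm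
    have hpt : ∀ ω, ‖(n : ℝ)⁻¹ • (∑ i ∈ Finset.range n, Z i ω) - μ‖
        ≤ ∑ a ∈ Finset.range L, ‖(q : ℝ)⁻¹ • (∑ b ∈ Finset.range q, Z (L * b + a) ω) - μ‖
          + (n : ℝ)⁻¹ * ∑ a ∈ Finset.range s, ‖Z (L * q + a) ω - μ‖ := by
      intro ω
      have e1 : (n : ℝ)⁻¹ • (∑ i ∈ Finset.range n, Z i ω) - μ
          = (n : ℝ)⁻¹ • ∑ i ∈ Finset.range n, (Z i ω - μ) := by
        rw [Finset.sum_sub_distrib, smul_sub, Finset.sum_const, Finset.card_range,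
          ← Nat.cast_smul_eq_nsmul ℝ, smul_smul, inv_mul_cancel₀ hn', one_smul]
      have e2 : ∀ a, ‖∑ b ∈ Finset.range q, (Z (L * b + a) ω - μ)‖
          ≤ n * ‖(q : ℝ)⁻¹ • (∑ b ∈ Finset.range q, Z (L * b + a) ω) - μ‖ := by
        intro a
        rcases Nat.eq_zero_or_pos q with hq | hq
        · rw [hq, Finset.range_zero, Finset.sum_empty, norm_zero]; positivity
        have hq' : (q : ℝ) ≠ 0 := by positivity
        have : ∑ b ∈ Finset.range q, (Z (L * b + a) ω - μ)
            = (q : ℝ) • ((q : ℝ)⁻¹ • (∑ b ∈ Finset.range q, Z (L * b + a) ω) - μ) := by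
          rw [Finset.sum_sub_distrib, smul_sub, Finset.sum_const, Finset.card_range,
            ← Nat.cast_smul_eq_nsmul ℝ, smul_smul, mul_inv_cancel₀ hq', one_smul]
        rw [this, norm_smul, Real.norm_of_nonneg (by positivity)]
        have : q ≤ n := Nat.div_le_self n L
        gcongr
      rw [e1, norm_smul, Real.norm_of_nonneg (by positivity), inv_mul_le_iff₀ (by positivity),
        mul_add, mul_inv_cancel_left₀ hn']
      nth_rw 1 [← hqs]
      rw [sum_range_mul_add, Finset.mul_sum]
      refine (norm_add_le _ _).trans (add_le_add ((norm_sum_le _ _).trans ?_) (norm_sum_le _ _))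
      exact Finset.sum_le_sum fun a _ => e2 a
    have hi2 : Integrable (fun ω => ∑ a ∈ Finset.range s, ‖Z (L * q + a) ω - μ‖) P :=
      integrable_finsetSum _ fun a _ => (hci _).norm
    have hi3 : Integrable (fun ω => ∑ a ∈ Finset.range L,
        ‖(q : ℝ)⁻¹ • (∑ b ∈ Finset.range q, Z (L * b + a) ω) - μ‖) P :=
      integrable_finsetSum _ fun a _ => hi1 a
    refine (integral_mono_of_nonneg (ae_of_all _ fun _ => norm_nonneg _)
      (hi3.add (hi2.const_mul _)) (ae_of_all _ hpt)).trans ?_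
    simp only [Pi.add_apply]
    rw [integral_add hi3 (hi2.const_mul _), integral_finsetSum _ fun a _ => hi1 a,
      integral_const_mul, integral_finsetSum _ fun a _ => (hci _).norm]
    simp only [hcen, Finset.sum_const, Finset.card_range, nsmul_eq_mul]
    have hs : s ≤ L := (Nat.mod_lt n hL).le
    have hc0 : 0 ≤ c := integral_nonneg fun _ => norm_nonneg _
    gcongr
  have hlim : Tendsto (fun n : ℕ => ∑ a ∈ Finset.range L, V a (n / L) + (n : ℝ)⁻¹ * (L * c))
      atTop (𝓝 0) := by
    have h1 : Tendsto (fun n : ℕ => ∑ a ∈ Finset.range L, V a (n / L)) atTop (𝓝 0) := by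
      have := tendsto_finsetSum (Finset.range L) fun a (_ : a ∈ Finset.range L) =>
        (hVlim a).comp (Nat.tendsto_div_const_atTop hL.ne')
      simpa using this
    have h2 : Tendsto (fun n : ℕ => (n : ℝ)⁻¹ * (L * c)) atTop (𝓝 0) := by
      simpa using (tendsto_inv_atTop_nhds_zero_nat (𝕜 := ℝ)).mul_const (L * c)
    simpa using h1.add h2
  refine squeeze_zero' (Eventually.of_forall fun n => integral_nonneg fun _ => norm_nonneg _) ?_
    hlim
  filter_upwards [eventually_gt_atTop 0] with n hn using hbound n hn

section

variable {Ω : Type*} [mΩ : MeasurableSpace Ω]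
  {H : Type*} [NormedAddCommGroup H] [InnerProductSpace ℝ H] [MeasurableSpace H]

/-- The empirical lag-`r` product `n⁻¹ ∑ x_i ⊗ x_{i + r}`, without centering at the sample mean. -/
def lagProduct (x : ℤ → Ω → H) (n r : ℕ) (ω : Ω) : H →L[ℝ] H :=
  (n : ℝ)⁻¹ • ∑ i ∈ Finset.Icc 1 (n - r), tensor (x (i : ℤ) ω) (x (i + r) ω)

namespace ShortMemory

variable {P : Measure Ω} {F : Set ℤ → MeasurableSpace Ω} {x : ℤ → Ω → H}
    {y : ℕ → ℤ → Ω → H} {M : ℝ} {δ : ℕ → ℝ} (hs : ShortMemory P F x y M δ)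
include hs

theorem integrable_lagProduct (n r : ℕ) : Integrable (lagProduct x n r) P :=
  (integrable_finsetSum (Finset.Icc 1 (n - r)) fun i _ => integrable_tensor (hs.memLp_x (i : ℤ))
    (hs.memLp_x (i + r))).smul (n : ℝ)⁻¹

theorem identDistrib_tensor_x [BorelSpace H] [SecondCountableTopology H]
    [MeasurableSpace (H →L[ℝ] H)] [BorelSpace (H →L[ℝ] H)] (r : ℕ) (j : ℤ) :
    IdentDistrib (fun ω => tensor (x j ω) (x (j + r) ω)) (fun ω => tensor (x 0 ω) (x r ω)) P P :=
  (hs.identDistrib_x r j).comp continuous_tensor.measurable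

theorem integral_tensor_x [BorelSpace H] [SecondCountableTopology H] (r : ℕ) (j : ℤ) :
    ∫ ω, tensor (x j ω) (x (j + r) ω) ∂P = autoCov P x r := by
  borelize (H →L[ℝ] H)
  exact (hs.identDistrib_tensor_x r j).integral_eq

theorem autoCov_neg [CompleteSpace H] [BorelSpace H] [SecondCountableTopology H] (r : ℕ) :
    autoCov P x (-r) = ContinuousLinearMap.adjoint (autoCov P x r) := by
  have h := hs.integral_tensor_x r (-r)
  have e : ∀ ω, tensor (x (-r) ω) (x (-r + r) ω)
      = ContinuousLinearMap.adjoint (tensor (x 0 ω) (x (-r) ω)) := fun ω => by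
    rw [adjoint_tensor]; simp
  simp only [e] at h
  rw [← h]
  have h2 := ContinuousLinearMap.integral_comp_commSL (μ := P) (σ := starRingEnd ℝ) (by simp)
    ((ContinuousLinearMap.adjoint (𝕜 := ℝ) (E := H) (F := H)).toContinuousLinearEquiv :
      (H →L[ℝ] H) →L⋆[ℝ] (H →L[ℝ] H)) (integrable_tensor (hs.memLp_x 0) (hs.memLp_x (-r)))
  exact (ContinuousLinearMap.adjoint_adjoint _).symm.trans (congrArg _ h2.symm)

/-- The lag-`r` product is small for large lags: replacing the later factor by its approximation
with memory `r` costs `M δ_r`. -/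
theorem exists_integral_norm_lagProduct_le [IsProbabilityMeasure P] [CompleteSpace H]
    [BorelSpace H] [SecondCountableTopology H] :
    ∃ C, 0 ≤ C ∧ ∀ n r : ℕ, 0 < n →
      ∫ ω, ‖lagProduct x n r ω‖ ∂P ≤ C / Real.sqrt n + M * δ r := by
  obtain ⟨C, hC, h⟩ := hs.exists_integral_norm_sum_tensor_sq_le
  refine ⟨Real.sqrt C, Real.sqrt_nonneg _, fun n r hn => ?_⟩
  have hn' : (0 : ℝ) < n := by exact_mod_cast hn
  set N := n - r
  have hN : (N : ℝ) ≤ n := by exact_mod_cast Nat.sub_le n r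
  set T : Ω → H →L[ℝ] H := fun ω => ∑ i ∈ Finset.Icc 1 N, tensor (x (i : ℤ) ω) (y r (i + r) ω)
  have hterm : ∀ i : ℤ, MemLp (fun ω => tensor (x i ω) (y r (i + r) ω)) 2 P := by
    intro i
    have hd : Disjoint (Set.Iic i) (Set.Ioc (i + r - r) (i + r)) :=
      Set.disjoint_left.2 fun k hk hk' => by
        simp only [Set.mem_Iic, Set.mem_Ioc] at hk hk'; omega
    have h2 := hs.memLp_norm_mul_norm hd (hs.measurable_x i) (hs.measurable_y r _) (hs.memLp_x i)
      (hs.memLp_y r _)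
    refine MemLp.of_le h2 (continuous_tensor.comp_aestronglyMeasurable
      ((hs.memLp_x i).1.prodMk (hs.memLp_y r _).1)) (ae_of_all _ fun ω => ?_)
    rw [norm_tensor, norm_mul, norm_norm, norm_norm]
  have hTm : MemLp T 2 P :=
    memLp_finsetSum (f := fun (i : ℕ) ω => tensor (x (i : ℤ) ω) (y r (i + r) ω))
      (Finset.Icc 1 N) fun i _ => hterm i
  have h1 : ∫ ω, ‖T ω‖ ∂P ≤ Real.sqrt n * Real.sqrt C := by
    refine integral_norm_le_of_sq hTm (by positivity) ((h N r).trans ?_)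
    rw [mul_pow, Real.sq_sqrt hn'.le, Real.sq_sqrt hC]
    gcongr
  have hpt : ∀ ω, ‖lagProduct x n r ω‖ ≤ (n : ℝ)⁻¹ * (‖T ω‖
      + ∑ i ∈ Finset.Icc 1 N, ‖x (i : ℤ) ω‖ * ‖x (i + r) ω - y r (i + r) ω‖) := by
    intro ω
    rw [lagProduct, norm_smul, Real.norm_of_nonneg (by positivity)]
    gcongr
    have : ∑ i ∈ Finset.Icc 1 N, tensor (x (i : ℤ) ω) (x (i + r) ω)
        = T ω + ∑ i ∈ Finset.Icc 1 N, tensor (x (i : ℤ) ω) (x (i + r) ω - y r (i + r) ω) := by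
      simp only [T, tensor_sub_right, Finset.sum_sub_distrib]; abel
    rw [this]
    refine (norm_add_le _ _).trans (add_le_add_right ((norm_sum_le _ _).trans ?_) _)
    exact Finset.sum_le_sum fun i _ => (norm_tensor _ _).le
  have hi : ∀ i ∈ Finset.Icc 1 N,
      Integrable (fun ω => ‖x (i : ℤ) ω‖ * ‖x (i + r) ω - y r (i + r) ω‖) P := fun i _ =>
    integrable_norm_mul_norm (hs.memLp_x _) (hs.memLp_sub r _)
  have hTi : Integrable (fun ω => ‖T ω‖) P := (hTm.integrable one_le_two).norm
  refine (integral_mono_of_nonneg (ae_of_all _ fun _ => norm_nonneg _)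
    ((hTi.add (integrable_finsetSum _ hi)).const_mul _) (ae_of_all _ hpt)).trans ?_
  simp only [Pi.add_apply]
  rw [integral_const_mul, integral_add hTi (integrable_finsetSum _ hi), integral_finsetSum _ hi]
  have h2 : ∑ i ∈ Finset.Icc 1 N, ∫ ω, ‖x (i : ℤ) ω‖ * ‖x (i + r) ω - y r (i + r) ω‖ ∂P
      ≤ n * (M * δ r) := by
    refine (Finset.sum_le_card_nsmul _ _ (M * δ r) fun i _ => integral_norm_mul_norm_le
      (hs.memLp_x _) (hs.memLp_sub r _) hs.nonneg (hs.err_nonneg r) (hs.sq_x _)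
      (hs.err r _)).trans ?_
    rw [nsmul_eq_mul, Nat.card_Icc, Nat.add_sub_cancel]
    have := mul_nonneg hs.nonneg (hs.err_nonneg r)
    gcongr
  calc (n : ℝ)⁻¹ * (_ + _) ≤ (n : ℝ)⁻¹ * (Real.sqrt n * Real.sqrt C + n * (M * δ r)) := by gcongr
    _ = Real.sqrt C / Real.sqrt n + M * δ r := by
      rw [mul_add, inv_mul_cancel_left₀ hn'.ne']
      congr 1
      have := Real.sqrt_pos.2 hn'
      nth_rw 1 [← Real.mul_self_sqrt hn'.le]
      field_simp

theorem integral_norm_tensor_sub_le (l r : ℕ) (j : ℤ) :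
    ∫ ω, ‖tensor (x j ω) (x (j + r) ω) - tensor (y l j ω) (y l (j + r) ω)‖ ∂P
      ≤ 2 * (M * δ l) := by
  have hi1 := integrable_norm_mul_norm (hs.memLp_x j) (hs.memLp_sub l (j + r))
  have hi2 := integrable_norm_mul_norm (hs.memLp_sub l j) (hs.memLp_y l (j + r))
  refine (integral_mono_of_nonneg (ae_of_all _ fun _ => norm_nonneg _) (hi1.add hi2)
    (ae_of_all _ fun ω => norm_tensor_sub_tensor_le _ _ _ _)).trans ?_
  simp only [Pi.add_apply]
  rw [integral_add hi1 hi2, two_mul]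
  refine add_le_add (integral_norm_mul_norm_le (hs.memLp_x j) (hs.memLp_sub l _) hs.nonneg
    (hs.err_nonneg l) (hs.sq_x j) (hs.err l _)) ?_
  rw [mul_comm M]
  exact integral_norm_mul_norm_le (hs.memLp_sub l j) (hs.memLp_y l _) (hs.err_nonneg l)
    hs.nonneg (hs.err l j) (hs.sq_y l _)

/-- The law of large numbers for the lag-`r` products with finite memory. -/
theorem tendsto_integral_norm_average_tensor_y [IsProbabilityMeasure P] [CompleteSpace H]
    [BorelSpace H] [SecondCountableTopology H] (l r : ℕ) :
    Tendsto (fun n : ℕ => ∫ ω, ‖(n : ℝ)⁻¹ • (∑ i ∈ Finset.Icc 1 n,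
        tensor (y l (i : ℤ) ω) (y l (i + r) ω)) - ∫ ω, tensor (y l 0 ω) (y l r ω) ∂P‖ ∂P)
      atTop (𝓝 0) := by
  borelize (H →L[ℝ] H)
  set Z : ℕ → Ω → H →L[ℝ] H := fun i ω =>
    tensor (y l ((i + 1 : ℕ) : ℤ) ω) (y l ((i + 1 : ℕ) + r) ω) with hZ
  have hid : ∀ i, IdentDistrib (Z i) (fun ω => tensor (y l 0 ω) (y l r ω)) P P := fun i =>
    (hs.identDistrib_y l r (i + 1 : ℕ)).comp continuous_tensor.measurable
  have hm : ∀ i : ℕ, Measurable[F (Set.Ioc (((i + 1 : ℕ) : ℤ) - l) ((i + 1 : ℕ) + r))] (Z i) := by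
    intro i
    have m1 : Measurable[F (Set.Ioc (((i + 1 : ℕ) : ℤ) - l) ((i + 1 : ℕ) + r))]
        (y l ((i + 1 : ℕ) : ℤ)) := (hs.measurable_y l _).mono (hs.mono fun k hk => by
          simp only [Set.mem_Ioc] at hk ⊢; omega) le_rfl
    have m2 : Measurable[F (Set.Ioc (((i + 1 : ℕ) : ℤ) - l) ((i + 1 : ℕ) + r))]
        (y l ((i + 1 : ℕ) + r)) := (hs.measurable_y l _).mono (hs.mono fun k hk => by
          simp only [Set.mem_Ioc] at hk ⊢; omega) le_rfl
    exact continuous_tensor.measurable.comp (m1.prodMk m2)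
  have h := tendsto_integral_norm_average_sub (P := P) Z (l + r + 1) (by omega)
    (integrable_tensor (hs.memLp_y l _) (hs.memLp_y l _))
    (fun i j hij => hs.indepFun (Set.disjoint_left.2 fun k hk hk' => by
      simp only [Set.mem_Ioc] at hk hk'; omega) (hm i) (hm j))
    (fun i => (hid i).trans (hid 0).symm)
  rw [(hid 0).integral_eq] at h
  refine h.congr fun n => ?_
  simp only [hZ, sum_Icc_one_eq_sum_range (fun i : ℕ => tensor (y l (i : ℤ) _) (y l (i + r) _))]

/-- The law of large numbers for the lag-`r` products. -/
theorem tendsto_integral_norm_lagProduct_sub [IsProbabilityMeasure P] [CompleteSpace H]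
    [BorelSpace H] [SecondCountableTopology H] (r : ℕ) :
    Tendsto (fun n : ℕ => ∫ ω, ‖lagProduct x n r ω - autoCov P x r‖ ∂P) atTop (𝓝 0) := by
  set C := autoCov P x r with hC
  have hbound : ∀ l n : ℕ, r < n → ∫ ω, ‖lagProduct x n r ω - C‖ ∂P
      ≤ 4 * (M * δ l) + (∫ ω, ‖((n - r : ℕ) : ℝ)⁻¹ • (∑ i ∈ Finset.Icc 1 (n - r),
        tensor (y l (i : ℤ) ω) (y l (i + r) ω)) - ∫ ω, tensor (y l 0 ω) (y l r ω) ∂P‖ ∂P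
        + (n : ℝ)⁻¹ * (r * ‖C‖)) := by
    intro l n hn
    have hn' : (0 : ℝ) < n := by exact_mod_cast (Nat.zero_le r).trans_lt hn
    set N := n - r with hN
    have hN0 : (0 : ℝ) < N := by exact_mod_cast Nat.sub_pos_of_lt hn
    have hNn : (N : ℝ) = n - r := by rw [hN, Nat.cast_sub hn.le]
    set m := ∫ ω, tensor (y l 0 ω) (y l r ω) ∂P with hm
    have hmC : ‖C - m‖ ≤ 2 * (M * δ l) := by
      have e : C - m = ∫ ω, (tensor (x 0 ω) (x (0 + r) ω) - tensor (y l 0 ω) (y l (0 + r) ω)) ∂P := by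
        rw [integral_sub (integrable_tensor (hs.memLp_x _) (hs.memLp_x _))
          (integrable_tensor (hs.memLp_y _ _) (hs.memLp_y _ _))]
        simp only [hC, hm, autoCov, zero_add]
      rw [e]
      exact (norm_integral_le_integral_norm _).trans (hs.integral_norm_tensor_sub_le l r 0)
    set D : ℕ → Ω → ℝ := fun i ω =>
      ‖tensor (x (i : ℤ) ω) (x (i + r) ω) - tensor (y l (i : ℤ) ω) (y l (i + r) ω)‖
    set A : Ω → H →L[ℝ] H := fun ω => (N : ℝ)⁻¹ • (∑ i ∈ Finset.Icc 1 N,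
        tensor (y l (i : ℤ) ω) (y l (i + r) ω)) - m
    have hD : ∀ i ∈ Finset.Icc 1 N, Integrable (D i) P := fun i _ =>
      ((integrable_tensor (hs.memLp_x _) (hs.memLp_x _)).sub
        (integrable_tensor (hs.memLp_y _ _) (hs.memLp_y _ _))).norm
    have hA : Integrable (fun ω => ‖A ω‖) P :=
      (((integrable_finsetSum (Finset.Icc 1 N) fun i _ =>
        integrable_tensor (hs.memLp_y l (i : ℤ)) (hs.memLp_y l (i + r))).smul (N : ℝ)⁻¹).sub
        (integrable_const m)).norm
    have hpt : ∀ ω, ‖lagProduct x n r ω - C‖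
        ≤ (n : ℝ)⁻¹ * ∑ i ∈ Finset.Icc 1 N, D i ω
          + (‖A ω‖ + (‖C - m‖ + (n : ℝ)⁻¹ * (r * ‖C‖))) := by
      intro ω
      have e : lagProduct x n r ω - C
          = (n : ℝ)⁻¹ • ∑ i ∈ Finset.Icc 1 N,
              (tensor (x (i : ℤ) ω) (x (i + r) ω) - tensor (y l (i : ℤ) ω) (y l (i + r) ω))
            + (((n : ℝ)⁻¹ * N) • A ω + (((n : ℝ)⁻¹ * N) • (m - C) - (n : ℝ)⁻¹ • ((r : ℝ) • C))) := by
        have h1 : (n : ℝ)⁻¹ * N = 1 - (n : ℝ)⁻¹ * r := by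
          rw [hNn]; field_simp
        have h2 : ((n : ℝ)⁻¹ * N) * (N : ℝ)⁻¹ = (n : ℝ)⁻¹ := by field_simp
        simp only [lagProduct, A, Finset.sum_sub_distrib, smul_sub, smul_smul, h2]
        rw [h1]
        module
      have h3 : (n : ℝ)⁻¹ * N ≤ 1 := by
        rw [inv_mul_le_iff₀ hn', hNn, mul_one]
        linarith [(Nat.cast_nonneg r : (0 : ℝ) ≤ r)]
      have h4 : 0 ≤ (n : ℝ)⁻¹ * N := by positivity
      rw [e]
      refine (norm_add_le _ _).trans (add_le_add ?_ ((norm_add_le _ _).trans (add_le_add ?_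
        ((norm_sub_le _ _).trans (add_le_add ?_ ?_)))))
      · rw [norm_smul, Real.norm_of_nonneg (by positivity)]
        gcongr
        exact norm_sum_le _ _
      · rw [norm_smul, Real.norm_of_nonneg h4]
        exact mul_le_of_le_one_left (norm_nonneg _) h3
      · rw [norm_smul, Real.norm_of_nonneg h4, norm_sub_rev]
        exact mul_le_of_le_one_left (norm_nonneg _) h3
      · rw [norm_smul, norm_smul, Real.norm_of_nonneg (by positivity),
          Real.norm_of_nonneg (by positivity)]
    have hDs : Integrable (fun ω => (n : ℝ)⁻¹ * ∑ i ∈ Finset.Icc 1 N, D i ω) P :=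
      (integrable_finsetSum _ hD).const_mul (n : ℝ)⁻¹
    have hAc : Integrable (fun ω => ‖A ω‖ + (‖C - m‖ + (n : ℝ)⁻¹ * (r * ‖C‖))) P :=
      hA.add (integrable_const _)
    refine (integral_mono_of_nonneg (ae_of_all _ fun _ => norm_nonneg _)
      (hDs.add hAc) (ae_of_all _ hpt)).trans ?_
    simp only [Pi.add_apply]
    rw [integral_add hDs hAc, integral_add hA (integrable_const _), integral_const_mul,
      integral_finsetSum _ hD, integral_const, probReal_univ, one_smul]
    have h5 : (n : ℝ)⁻¹ * ∑ i ∈ Finset.Icc 1 N, ∫ ω, D i ω ∂P ≤ 2 * (M * δ l) := by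
      rw [inv_mul_le_iff₀ hn']
      refine (Finset.sum_le_card_nsmul (Finset.Icc 1 N) (fun i => ∫ ω, D i ω ∂P) _ fun i _ =>
        hs.integral_norm_tensor_sub_le l r i).trans ?_
      rw [nsmul_eq_mul, Nat.card_Icc, Nat.add_sub_cancel]
      have := mul_nonneg hs.nonneg (hs.err_nonneg l)
      have : (N : ℝ) ≤ n := by rw [hNn]; linarith [(Nat.cast_nonneg r : (0 : ℝ) ≤ r)]
      gcongr
    linarith
  rw [Metric.tendsto_atTop]
  intro e he
  obtain ⟨l, hl⟩ : ∃ l, 4 * (M * δ l) < e / 2 := by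
    have : Tendsto (fun l => 4 * (M * δ l)) atTop (𝓝 0) := by
      simpa using (hs.summable.tendsto_atTop_zero.const_mul M).const_mul 4
    exact (this.eventually (gt_mem_nhds (half_pos he))).exists
  have h1 := ((hs.tendsto_integral_norm_average_tensor_y l r).comp
    (tendsto_sub_atTop_nat r)).add
    ((tendsto_inv_atTop_nhds_zero_nat (𝕜 := ℝ)).mul_const (r * ‖C‖))
  rw [zero_mul, add_zero] at h1
  have h2 := (h1.eventually (gt_mem_nhds (half_pos he))).and (eventually_gt_atTop r)
  obtain ⟨n₀, hn₀⟩ := eventually_atTop.1 h2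
  refine ⟨n₀, fun n hn => ?_⟩
  obtain ⟨h3, h4⟩ := hn₀ n hn
  rw [Real.dist_0_eq_abs, abs_of_nonneg (integral_nonneg fun _ => norm_nonneg _)]
  have h5 := hbound l n h4
  simp only [Function.comp_apply] at h3
  linarith

end ShortMemory

end

/-! ### Empirical lagged covariances -/

section LagCov

variable {H : Type*} [NormedAddCommGroup H] [InnerProductSpace ℝ H]

theorem lagCov_natCast (n : ℕ) (X : ℕ → H) (r : ℕ) :
    lagCov n X r = (n : ℝ)⁻¹ • ∑ i ∈ Finset.Icc 1 (n - r),
      tensor (X i - sampleMean n X) (X (i + r) - sampleMean n X) := by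
  simp [lagCov]

theorem lagCov_neg [CompleteSpace H] (n : ℕ) (X : ℕ → H) (r : ℕ) :
    lagCov n X (-r) = ContinuousLinearMap.adjoint (lagCov n X r) := by
  rw [lagCov_natCast, map_smulₛₗ, map_sum]
  simp only [adjoint_tensor]
  rcases Nat.eq_zero_or_pos r with rfl | hr
  · simp [lagCov]
  · rw [lagCov, if_neg (by omega)]
    simp

theorem norm_lagCov_sub_eq_natAbs [CompleteSpace H] (n : ℕ) (X Y : ℕ → H) (r : ℤ) :
    ‖lagCov n X r - lagCov n Y r‖ = ‖lagCov n X r.natAbs - lagCov n Y r.natAbs‖ := by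
  rcases Int.natAbs_eq r with h | h
  · rw [← h]
  · rw [h, lagCov_neg, lagCov_neg, ← map_sub, LinearIsometryEquiv.norm_map, Int.natAbs_neg,
      Int.natAbs_natCast]

theorem sum_Icc_shift_le (f : ℕ → ℝ) (hf : ∀ i, 0 ≤ f i) (n r : ℕ) :
    ∑ i ∈ Finset.Icc 1 (n - r), f (i + r) ≤ ∑ i ∈ Finset.Icc 1 n, f i := by
  refine (Finset.sum_map (Finset.Icc 1 (n - r)) (addRightEmbedding r) f).symm.trans_le ?_
  refine Finset.sum_le_sum_of_subset_of_nonneg (fun i hi => ?_) fun i _ _ => hf i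
  simp only [Finset.mem_map, Finset.mem_Icc, addRightEmbedding_apply] at hi ⊢
  omega

/-- Perturbing all vectors by at most `D` changes an averaged lagged product by at most
`D (D + 2 N)`, where `N` is the average of the norms. -/
theorem norm_average_tensor_sub_le (n r : ℕ) (p q : ℕ → H) (D : ℝ) (hD : 0 ≤ D)
    (h : ∀ i ∈ Finset.Icc 1 n, ‖p i - q i‖ ≤ D) :
    ‖(n : ℝ)⁻¹ • ∑ i ∈ Finset.Icc 1 (n - r), tensor (p i) (p (i + r))
      - (n : ℝ)⁻¹ • ∑ i ∈ Finset.Icc 1 (n - r), tensor (q i) (q (i + r))‖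
      ≤ D * (D + 2 * ((n : ℝ)⁻¹ * ∑ i ∈ Finset.Icc 1 n, ‖q i‖)) := by
  rcases Nat.eq_zero_or_pos n with rfl | hn
  · simp; positivity
  have hn' : (0 : ℝ) < n := by exact_mod_cast hn
  rw [← smul_sub, ← Finset.sum_sub_distrib, norm_smul, Real.norm_of_nonneg (by positivity),
    inv_mul_le_iff₀ hn']
  have h1 : ∀ i ∈ Finset.Icc 1 (n - r), ‖tensor (p i) (p (i + r)) - tensor (q i) (q (i + r))‖
      ≤ D * (D + (‖q i‖ + ‖q (i + r)‖)) := by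
    intro i hi
    rw [Finset.mem_Icc] at hi
    have h2 := h i (Finset.mem_Icc.2 (by omega))
    have h3 := h (i + r) (Finset.mem_Icc.2 (by omega))
    have h4 : ‖p i‖ ≤ ‖q i‖ + D := by
      have := norm_add_le (q i) (p i - q i)
      rw [add_sub_cancel] at this
      linarith
    calc _ ≤ ‖p i‖ * ‖p (i + r) - q (i + r)‖ + ‖p i - q i‖ * ‖q (i + r)‖ :=
          norm_tensor_sub_tensor_le _ _ _ _
      _ ≤ (‖q i‖ + D) * D + D * ‖q (i + r)‖ := by gcongr
      _ = _ := by ring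
  refine (norm_sum_le _ _).trans ((Finset.sum_le_sum h1).trans ?_)
  rw [← Finset.mul_sum, Finset.sum_add_distrib, Finset.sum_add_distrib, Finset.sum_const,
    Nat.card_Icc, nsmul_eq_mul, Nat.add_sub_cancel]
  have h5 : ∑ i ∈ Finset.Icc 1 (n - r), ‖q i‖ ≤ ∑ i ∈ Finset.Icc 1 n, ‖q i‖ :=
    Finset.sum_le_sum_of_subset_of_nonneg (Finset.Icc_subset_Icc_right (Nat.sub_le n r))
      fun i _ _ => norm_nonneg _
  have h6 := sum_Icc_shift_le (fun i => ‖q i‖) (fun i => norm_nonneg _) n r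
  have h7 : ((n - r : ℕ) : ℝ) ≤ n := by exact_mod_cast Nat.sub_le n r
  have e : (n : ℝ) * (D * (D + 2 * ((n : ℝ)⁻¹ * ∑ i ∈ Finset.Icc 1 n, ‖q i‖)))
      = D * (n * D + (∑ i ∈ Finset.Icc 1 n, ‖q i‖ + ∑ i ∈ Finset.Icc 1 n, ‖q i‖)) := by
    field_simp; ring
  rw [e]
  gcongr

theorem norm_sampleMean_le (n : ℕ) (X : ℕ → H) :
    ‖sampleMean n X‖ ≤ (n : ℝ)⁻¹ * ∑ i ∈ Finset.Icc 1 n, ‖X i‖ := by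
  rw [sampleMean, norm_smul, Real.norm_of_nonneg (by positivity)]
  gcongr
  exact norm_sum_le _ _

theorem average_norm_sub_sampleMean_le (n : ℕ) (X : ℕ → H) :
    (n : ℝ)⁻¹ * ∑ i ∈ Finset.Icc 1 n, ‖X i - sampleMean n X‖
      ≤ 2 * ((n : ℝ)⁻¹ * ∑ i ∈ Finset.Icc 1 n, ‖X i‖) := by
  rcases Nat.eq_zero_or_pos n with rfl | hn
  · simp
  have hn' : (0 : ℝ) < n := by exact_mod_cast hn
  calc (n : ℝ)⁻¹ * ∑ i ∈ Finset.Icc 1 n, ‖X i - sampleMean n X‖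
      ≤ (n : ℝ)⁻¹ * ∑ i ∈ Finset.Icc 1 n, (‖X i‖ + ‖sampleMean n X‖) := by
        gcongr; exact norm_sub_le _ _
    _ = (n : ℝ)⁻¹ * ∑ i ∈ Finset.Icc 1 n, ‖X i‖ + ‖sampleMean n X‖ := by
        rw [Finset.sum_add_distrib, Finset.sum_const, Nat.card_Icc, Nat.add_sub_cancel,
          nsmul_eq_mul, mul_add, inv_mul_cancel_left₀ hn'.ne']
    _ ≤ _ := by linarith [norm_sampleMean_le n X]

/-- A signal whose deviations from a constant are bounded by `D` changes each empirical lagged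
covariance by at most `2 D (2 D + 4 N)`, where `N` is the average norm of the noise. -/
theorem norm_lagCov_add_sub_le [CompleteSpace H] (n : ℕ) (s u : ℕ → H) (c : H) (D : ℝ)
    (hD : 0 ≤ D) (hs : ∀ i ∈ Finset.Icc 1 n, ‖s i - c‖ ≤ D) (r : ℤ) :
    ‖lagCov n (fun i => s i + u i) r - lagCov n u r‖
      ≤ 2 * D * (2 * D + 4 * ((n : ℝ)⁻¹ * ∑ i ∈ Finset.Icc 1 n, ‖u i‖)) := by
  rcases Nat.eq_zero_or_pos n with rfl | hn
  · have : ∀ X : ℕ → H, lagCov 0 X r = 0 := fun X => by simp [lagCov]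
    rw [this, this, sub_self, norm_zero]
    positivity
  have hn' : (0 : ℝ) < n := by exact_mod_cast hn
  rw [norm_lagCov_sub_eq_natAbs, lagCov_natCast, lagCov_natCast]
  have hm : sampleMean n (fun i => s i + u i) = sampleMean n s + sampleMean n u := by
    simp only [sampleMean, Finset.sum_add_distrib, smul_add]
  have hms : ‖sampleMean n s - c‖ ≤ D := by
    have e : sampleMean n s - c = (n : ℝ)⁻¹ • ∑ i ∈ Finset.Icc 1 n, (s i - c) := by
      rw [Finset.sum_sub_distrib, smul_sub, Finset.sum_const, Nat.card_Icc, Nat.add_sub_cancel,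
        ← Nat.cast_smul_eq_nsmul ℝ, smul_smul, inv_mul_cancel₀ hn'.ne', one_smul, sampleMean]
    rw [e, norm_smul, Real.norm_of_nonneg (by positivity), inv_mul_le_iff₀ hn']
    refine (norm_sum_le _ _).trans ((Finset.sum_le_card_nsmul _ _ _ hs).trans (le_of_eq ?_))
    simp
  refine (norm_average_tensor_sub_le n r.natAbs
    (fun i => s i + u i - sampleMean n fun i => s i + u i) (fun i => u i - sampleMean n u)
    (2 * D) (by positivity) fun i hi => ?_).trans ?_
  · simp only [hm]
    have e : s i + u i - (sampleMean n s + sampleMean n u) - (u i - sampleMean n u)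
        = (s i - c) - (sampleMean n s - c) := by abel
    rw [e]
    linarith [norm_sub_le (s i - c) (sampleMean n s - c), hs i hi]
  · have := average_norm_sub_sampleMean_le n u
    refine mul_le_mul_of_nonneg_left ?_ (by positivity)
    linarith

end LagCov

section

variable {Ω : Type*} [mΩ : MeasurableSpace Ω]
  {H : Type*} [NormedAddCommGroup H] [InnerProductSpace ℝ H] [MeasurableSpace H]

namespace ShortMemory

variable {P : Measure Ω} {F : Set ℤ → MeasurableSpace Ω} {x : ℤ → Ω → H}
    {y : ℕ → ℤ → Ω → H} {M : ℝ} {δ : ℕ → ℝ} (hs : ShortMemory P F x y M δ)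
include hs

theorem memLp_sampleMean (n : ℕ) :
    MemLp (fun ω => sampleMean n fun i => x (i : ℤ) ω) 2 P :=
  (memLp_finsetSum (f := fun (i : ℕ) ω => x (i : ℤ) ω) (Finset.Icc 1 n)
    fun i _ => hs.memLp_x i).const_smul (n : ℝ)⁻¹

theorem integrable_lagCov (n r : ℕ) :
    Integrable (fun ω => lagCov n (fun i => x (i : ℤ) ω) r) P := by
  simp only [lagCov_natCast]
  exact (integrable_finsetSum (Finset.Icc 1 (n - r)) fun i _ =>
    integrable_tensor ((hs.memLp_x (i : ℤ)).sub (hs.memLp_sampleMean n))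
      ((hs.memLp_x ((i + r : ℕ) : ℤ)).sub (hs.memLp_sampleMean n))).smul (n : ℝ)⁻¹

theorem norm_lagCov_sub_autoCov_eq_natAbs [CompleteSpace H] [BorelSpace H]
    [SecondCountableTopology H] (n : ℕ) (X : ℕ → H) (r : ℤ) :
    ‖lagCov n X r - autoCov P x r‖ = ‖lagCov n X r.natAbs - autoCov P x r.natAbs‖ := by
  rcases Int.natAbs_eq r with h | h
  · rw [← h]
  · rw [h, lagCov_neg, hs.autoCov_neg, ← map_sub, LinearIsometryEquiv.norm_map, Int.natAbs_neg,
      Int.natAbs_natCast]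

theorem integral_average_norm_le [IsProbabilityMeasure P] (n : ℕ) :
    ∫ ω, (n : ℝ)⁻¹ * ∑ i ∈ Finset.Icc 1 n, ‖x (i : ℤ) ω‖ ∂P ≤ M := by
  rcases Nat.eq_zero_or_pos n with rfl | hn
  · simpa using hs.nonneg
  have hn' : (0 : ℝ) < n := by exact_mod_cast hn
  rw [integral_const_mul,
    integral_finsetSum (Finset.Icc 1 n) fun i _ => (hs.integrable_x (i : ℤ)).norm, inv_mul_le_iff₀ hn']
  refine (Finset.sum_le_card_nsmul (Finset.Icc 1 n) (fun i => ∫ ω, ‖x (i : ℤ) ω‖ ∂P) _ fun i _ =>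
    integral_norm_le_of_sq (hs.memLp_x i) hs.nonneg (hs.sq_x i)).trans (le_of_eq ?_)
  simp

variable [IsProbabilityMeasure P] [CompleteSpace H] [BorelSpace H]

/-- Centering at the sample mean changes each lagged product by a term of order `n ^ (-1/2)`,
uniformly in the lag. -/
theorem exists_integral_norm_lagCov_sub_lagProduct_le :
    ∃ C, 0 ≤ C ∧ ∀ n r : ℕ, 0 < n →
      ∫ ω, ‖lagCov n (fun i => x (i : ℤ) ω) r - lagProduct x n r ω‖ ∂P ≤ C / Real.sqrt n := by
  set V := M ^ 2 + 2 * (M * ∑' l, δ l) with hV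
  have hS : 0 ≤ ∑' l, δ l := tsum_nonneg hs.err_nonneg
  have hM := hs.nonneg
  have hV0 : 0 ≤ V := by positivity
  refine ⟨V + 2 * (Real.sqrt V * M), by positivity, fun n r hn => ?_⟩
  have hn' : (0 : ℝ) < n := by exact_mod_cast hn
  have hsq := Real.sqrt_pos.2 hn'
  set m : Ω → H := fun ω => sampleMean n fun i => x (i : ℤ) ω with hm
  have hmL := hs.memLp_sampleMean n
  have hm2 : ∫ ω, ‖m ω‖ ^ 2 ∂P ≤ (Real.sqrt V / Real.sqrt n) ^ 2 := by
    simp only [hm, sampleMean, norm_smul, mul_pow]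
    rw [integral_const_mul, Real.norm_of_nonneg (by positivity), div_pow, Real.sq_sqrt hV0,
      Real.sq_sqrt hn'.le]
    calc ((n : ℝ)⁻¹) ^ 2 * _ ≤ ((n : ℝ)⁻¹) ^ 2 * (n * V) := by
          gcongr; exact hs.integral_norm_sum_x_sq_le n
      _ = V / n := by field_simp
  have hpt : ∀ ω, ‖lagCov n (fun i => x (i : ℤ) ω) r - lagProduct x n r ω‖
      ≤ ‖m ω‖ ^ 2 + (2 * (n : ℝ)⁻¹) * ∑ i ∈ Finset.Icc 1 n, ‖m ω‖ * ‖x (i : ℤ) ω‖ := by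
    intro ω
    rw [lagCov_natCast, lagProduct]
    have := norm_average_tensor_sub_le n r (fun i => x (i : ℤ) ω - m ω) (fun i => x (i : ℤ) ω)
      ‖m ω‖ (norm_nonneg _) fun i _ => by simp
    push_cast at this ⊢
    refine this.trans (le_of_eq ?_)
    rw [← Finset.mul_sum]; ring
  have hi1 : Integrable (fun ω => ‖m ω‖ ^ 2) P := integrable_norm_sq hmL
  have hi2 : ∀ i ∈ Finset.Icc 1 n, Integrable (fun ω => ‖m ω‖ * ‖x (i : ℤ) ω‖) P := fun i _ =>
    integrable_norm_mul_norm hmL (hs.memLp_x i)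
  have hi3 : Integrable
      (fun ω => (2 * (n : ℝ)⁻¹) * ∑ i ∈ Finset.Icc 1 n, ‖m ω‖ * ‖x (i : ℤ) ω‖) P :=
    (integrable_finsetSum _ hi2).const_mul _
  refine (integral_mono_of_nonneg (ae_of_all _ fun _ => norm_nonneg _) (hi1.add hi3)
    (ae_of_all _ hpt)).trans ?_
  simp only [Pi.add_apply]
  rw [integral_add hi1 hi3, integral_const_mul, integral_finsetSum _ hi2]
  have h1 : ∑ i ∈ Finset.Icc 1 n, ∫ ω, ‖m ω‖ * ‖x (i : ℤ) ω‖ ∂P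
      ≤ n * (Real.sqrt V / Real.sqrt n * M) := by
    refine (Finset.sum_le_card_nsmul (Finset.Icc 1 n) _ _ fun i _ => integral_norm_mul_norm_le hmL
      (hs.memLp_x i) (by positivity) hs.nonneg hm2 (hs.sq_x i)).trans (le_of_eq ?_)
    simp
  calc _ ≤ (Real.sqrt V / Real.sqrt n) ^ 2
        + 2 * (n : ℝ)⁻¹ * (n * (Real.sqrt V / Real.sqrt n * M)) := by gcongr
    _ = V / n + 2 * (Real.sqrt V * M) / Real.sqrt n := by
        rw [div_pow, Real.sq_sqrt hV0, Real.sq_sqrt hn'.le]; field_simp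
    _ ≤ V / Real.sqrt n + 2 * (Real.sqrt V * M) / Real.sqrt n := by
        gcongr
        rw [Real.sqrt_le_left hn'.le]
        have : (1 : ℝ) ≤ n := by exact_mod_cast hn
        nlinarith
    _ = _ := by ring

variable [SecondCountableTopology H]

/-- The mean error of the empirical lagged covariances is of order `n ^ (-1/2)`, up to a term that
is summable in the lag. -/
theorem exists_integral_norm_lagCov_sub_le
    (hC : Summable fun r : ℕ => ‖autoCov P x r‖) :
    ∃ (C : ℝ) (b : ℕ → ℝ), Summable b ∧ ∀ n r : ℕ, 0 < n →
      ∫ ω, ‖lagCov n (fun i => x (i : ℤ) ω) r - autoCov P x r‖ ∂P ≤ C / Real.sqrt n + b r := by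
  obtain ⟨C₁, -, h₁⟩ := hs.exists_integral_norm_lagCov_sub_lagProduct_le
  obtain ⟨C₂, -, h₂⟩ := hs.exists_integral_norm_lagProduct_le
  refine ⟨C₁ + C₂, fun r => M * δ r + ‖autoCov P x r‖, (hs.summable.mul_left M).add hC,
    fun n r hn => ?_⟩
  have hi1 : Integrable (fun ω => ‖lagCov n (fun i => x (i : ℤ) ω) r - lagProduct x n r ω‖) P :=
    ((hs.integrable_lagCov n r).sub (hs.integrable_lagProduct n r)).norm
  have hi2 := (hs.integrable_lagProduct n r).norm
  have hi3 : Integrable (fun ω => ‖lagProduct x n r ω‖ + ‖autoCov P x r‖) P :=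
    hi2.add (integrable_const _)
  have h3 : ∫ ω, ‖lagCov n (fun i => x (i : ℤ) ω) r - autoCov P x r‖ ∂P
      ≤ ∫ ω, (‖lagCov n (fun i => x (i : ℤ) ω) r - lagProduct x n r ω‖
        + (‖lagProduct x n r ω‖ + ‖autoCov P x r‖)) ∂P := by
    refine integral_mono_of_nonneg (ae_of_all _ fun _ => norm_nonneg _) (hi1.add hi3)
      (ae_of_all _ fun ω => ?_)
    exact (norm_sub_le_norm_sub_add_norm_sub _ (lagProduct x n r ω) _).trans
      (add_le_add le_rfl (norm_sub_le _ _))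
  rw [integral_add hi1 hi3, integral_add hi2 (integrable_const _), integral_const, probReal_univ,
    one_smul] at h3
  have := h₁ n r hn
  have := h₂ n r hn
  rw [add_div]
  linarith

theorem tendsto_integral_norm_lagCov_sub (r : ℕ) :
    Tendsto (fun n : ℕ => ∫ ω, ‖lagCov n (fun i => x (i : ℤ) ω) r - autoCov P x r‖ ∂P)
      atTop (𝓝 0) := by
  obtain ⟨C, -, h⟩ := hs.exists_integral_norm_lagCov_sub_lagProduct_le
  have h0 : Tendsto (fun n : ℕ => C / Real.sqrt n) atTop (𝓝 0) :=
    tendsto_const_nhds.div_atTop (Real.tendsto_sqrt_atTop.comp tendsto_natCast_atTop_atTop)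
  have h1 := h0.add (hs.tendsto_integral_norm_lagProduct_sub r)
  rw [add_zero] at h1
  refine squeeze_zero' (Eventually.of_forall fun n => integral_nonneg fun _ => norm_nonneg _) ?_ h1
  filter_upwards [eventually_gt_atTop 0] with n hn
  have hi1 := ((hs.integrable_lagCov n r).sub (hs.integrable_lagProduct n r)).norm
  have hi2 := ((hs.integrable_lagProduct n r).sub (integrable_const (autoCov P x r))).norm
  refine (integral_mono_of_nonneg (ae_of_all _ fun _ => norm_nonneg _) (hi1.add hi2)
    (ae_of_all _ fun ω => norm_sub_le_norm_sub_add_norm_sub _ (lagProduct x n r ω) _)).trans ?_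
  simp only [Pi.add_apply]
  rw [integral_add hi1 hi2]
  exact add_le_add (h n r hn) le_rfl

end ShortMemory

end

/-! ### Kernel weights -/

theorem IsKernel.exists_support {K : ℝ → ℝ} (hK : IsKernel K) :
    ∃ A, 0 < A ∧ ∀ t, A < |t| → K t = 0 := by
  obtain ⟨A, hA⟩ := hK.compactSupport.isCompact.isBounded.subset_closedBall 0
  refine ⟨max A 1, by positivity, fun t ht => image_eq_zero_of_notMem_tsupport fun h => ?_⟩
  have := hA h
  rw [mem_closedBall_zero_iff, Real.norm_eq_abs] at this
  exact absurd (le_max_left A 1) (by linarith)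

/-- Only the lags up to a multiple of the bandwidth carry weight. -/
theorem IsKernel.exists_sum_abs_le {K : ℝ → ℝ} (hK : IsKernel K) :
    ∃ A, 0 < A ∧ ∀ b : ℝ, 0 < b → ∀ n : ℕ,
      ∑ r ∈ Finset.Icc (-(n : ℤ)) n, |K (r / b)| ≤ 2 * (A * b) + 1 := by
  obtain ⟨A, hA, h⟩ := hK.exists_support
  refine ⟨A, hA, fun b hb n => ?_⟩
  set N := ⌊A * b⌋₊
  have h1 : ∀ r : ℤ, r ∉ Finset.Icc (-(N : ℤ)) N → K (r / b) = 0 := by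
    intro r hr
    refine h _ ?_
    rw [abs_div, abs_of_pos hb, lt_div_iff₀ hb]
    have h2 : N < r.natAbs := by
      rw [Finset.mem_Icc] at hr; omega
    have h3 := (Nat.floor_lt (by positivity)).1 h2
    rwa [Nat.cast_natAbs, Int.cast_abs] at h3
  calc ∑ r ∈ Finset.Icc (-(n : ℤ)) n, |K (r / b)|
      ≤ ∑ r ∈ Finset.Icc (-(n : ℤ)) n, if r ∈ Finset.Icc (-(N : ℤ)) N then (1 : ℝ) else 0 := by
        refine Finset.sum_le_sum fun r _ => ?_
        split_ifs with hr
        · exact hK.bounded _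
        · rw [h1 r hr, abs_zero]
    _ ≤ ((Finset.Icc (-(N : ℤ)) N).card : ℝ) := by
        rw [Finset.sum_ite_mem, Finset.sum_const, nsmul_eq_mul, mul_one]
        exact_mod_cast Finset.card_le_card Finset.inter_subset_right
    _ = 2 * (N : ℝ) + 1 := by
        rw [Int.card_Icc, show ((N : ℤ) + 1 - -(N : ℤ)).toNat = 2 * N + 1 by omega]
        push_cast; ring
    _ ≤ _ := by
        have := Nat.floor_le (show 0 ≤ A * b by positivity)
        linarith

theorem tendsto_sum_abs_kernel_div_sqrt {K : ℝ → ℝ} (hK : IsKernel K) {h : ℕ → ℝ}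
    (hh : IsBandwidth h) :
    Tendsto (fun n : ℕ => (∑ r ∈ Finset.Icc (-(n : ℤ)) n, |K (r / h n)|) / Real.sqrt n)
      atTop (𝓝 0) := by
  obtain ⟨A, hA, hb⟩ := hK.exists_sum_abs_le
  have h1 : Tendsto (fun n : ℕ => 2 * A * (h n / Real.sqrt n) + 1 / Real.sqrt n) atTop (𝓝 0) := by
    simpa using (hh.tendsto_div_sqrt.const_mul (2 * A)).add (tendsto_const_nhds.div_atTop
      (Real.tendsto_sqrt_atTop.comp tendsto_natCast_atTop_atTop) (a := (1 : ℝ)))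
  refine squeeze_zero' (Eventually.of_forall fun n => by positivity) ?_ h1
  filter_upwards [hh.tendsto_atTop.eventually_gt_atTop 0] with n hn
  calc _ ≤ (2 * (A * h n) + 1) / Real.sqrt n := by gcongr; exact hb _ hn n
    _ = _ := by ring

/-- Kernel-weighted sums of the errors at single lags tend to zero, when these errors are of order
`n ^ (-1/2)` up to a summable function of the lag, because the bandwidth is `o(√n)`. -/
theorem tendsto_sum_abs_kernel_mul {K : ℝ → ℝ} (hK : IsKernel K) {h : ℕ → ℝ}
    (hh : IsBandwidth h) (e : ℕ → ℕ → ℝ) (he : ∀ n r, 0 ≤ e n r) (C : ℝ) (b : ℕ → ℝ)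
    (hb : Summable b) (hle : ∀ n r : ℕ, 0 < n → e n r ≤ C / Real.sqrt n + b r)
    (hlim : ∀ r, Tendsto (fun n => e n r) atTop (𝓝 0)) :
    Tendsto (fun n : ℕ => ∑ r ∈ Finset.Icc (-(n : ℤ)) n, |K (r / h n)| * e n r.natAbs)
      atTop (𝓝 0) := by
  set g : ℕ → ℤ → ℝ := fun n r => max (e n r.natAbs - C / Real.sqrt n) 0 with hg
  have hbs : Summable fun r : ℤ => |b r.natAbs| := by
    refine Summable.of_nat_of_neg ?_ ?_ <;> simpa using hb.abs
  have hgle : ∀ n : ℕ, 0 < n → ∀ r, ‖g n r‖ ≤ |b r.natAbs| := by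
    intro n hn r
    rw [Real.norm_of_nonneg (le_max_right _ _)]
    refine max_le ?_ (abs_nonneg _)
    linarith [hle n r.natAbs hn, le_abs_self (b r.natAbs)]
  have hC0 : Tendsto (fun n : ℕ => C / Real.sqrt n) atTop (𝓝 0) :=
    tendsto_const_nhds.div_atTop (Real.tendsto_sqrt_atTop.comp tendsto_natCast_atTop_atTop)
  have h1 : Tendsto (fun n => ∑' r, g n r) atTop (𝓝 0) := by
    have := tendsto_tsum_of_dominated_convergence (f := g) (g := fun _ => 0) hbs
      (fun r => by simpa [hg] using ((hlim r.natAbs).sub hC0).max (tendsto_const_nhds (x := (0 : ℝ))))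
      ((eventually_gt_atTop 0).mono hgle)
    simpa using this
  have h2 := ((tendsto_sum_abs_kernel_div_sqrt hK hh).const_mul C).add h1
  rw [mul_zero, add_zero] at h2
  refine squeeze_zero' (Eventually.of_forall fun n => Finset.sum_nonneg fun r _ =>
    mul_nonneg (abs_nonneg _) (he _ _)) ?_ h2
  filter_upwards [eventually_gt_atTop 0] with n hn
  have hsum : Summable (g n) := Summable.of_norm_bounded hbs (hgle n hn)
  calc ∑ r ∈ Finset.Icc (-(n : ℤ)) n, |K (r / h n)| * e n r.natAbs
      ≤ ∑ r ∈ Finset.Icc (-(n : ℤ)) n, (|K (r / h n)| * (C / Real.sqrt n) + g n r) := by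
        refine Finset.sum_le_sum fun r _ => ?_
        have h3 : e n r.natAbs ≤ C / Real.sqrt n + g n r := by
          linarith [le_max_left (e n r.natAbs - C / Real.sqrt n) 0]
        have h4 : |K (r / h n)| * g n r ≤ g n r :=
          mul_le_of_le_one_left (le_max_right _ _) (hK.bounded _)
        calc _ ≤ |K (r / h n)| * (C / Real.sqrt n + g n r) := by gcongr
          _ ≤ _ := by rw [mul_add]; gcongr
    _ = C * ((∑ r ∈ Finset.Icc (-(n : ℤ)) n, |K (r / h n)|) / Real.sqrt n)
        + ∑ r ∈ Finset.Icc (-(n : ℤ)) n, g n r := by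
        rw [Finset.sum_add_distrib, ← Finset.sum_mul]; ring
    _ ≤ _ := by
        gcongr
        exact hsum.sum_le_tsum _ fun r _ => le_max_right _ _

/-- The bias of the kernel weights vanishes. -/
theorem tendsto_sum_kernel_smul {G : Type*} [NormedAddCommGroup G] [NormedSpace ℝ G]
    [CompleteSpace G] {K : ℝ → ℝ} (hK : IsKernel K) {h : ℕ → ℝ} (hh : IsBandwidth h)
    (c : ℤ → G) (hc : Summable fun r => ‖c r‖) :
    Tendsto (fun n : ℕ => ∑ r ∈ Finset.Icc (-(n : ℤ)) n, K (r / h n) • c r) atTop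
      (𝓝 (∑' r, c r)) := by
  have h1 := tendsto_tsum_of_dominated_convergence (𝓕 := atTop)
    (f := fun (n : ℕ) (r : ℤ) => if r ∈ Finset.Icc (-(n : ℤ)) n then K (r / h n) • c r else 0)
    (g := c) hc (fun r => ?_) (Eventually.of_forall fun n r => ?_)
  · refine h1.congr fun n => ?_
    rw [tsum_eq_sum (s := Finset.Icc (-(n : ℤ)) n) fun r hr => if_neg hr]
    exact Finset.sum_congr rfl fun r hr => if_pos hr
  · have h2 : Tendsto (fun n : ℕ => K (r / h n) • c r) atTop (𝓝 (c r)) := by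
      have h3 : Tendsto (fun n : ℕ => (r : ℝ) / h n) atTop (𝓝 0) :=
        tendsto_const_nhds.div_atTop hh.tendsto_atTop
      have h4 := ((hK.continuous.tendsto 0).comp h3).smul_const (c r)
      rwa [hK.at_zero, one_smul] at h4
    refine h2.congr' ?_
    filter_upwards [eventually_ge_atTop r.natAbs] with n hn
    rw [if_pos (Finset.mem_Icc.2 (by omega))]
  · split_ifs
    · rw [norm_smul]
      exact mul_le_of_le_one_left (norm_nonneg _) (hK.bounded _)
    · rw [norm_zero]; exact norm_nonneg _

/-! ### Consistency of the kernel estimator -/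

section

variable {Ω : Type*} [mΩ : MeasurableSpace Ω] {P : Measure Ω}

theorem tendsto_measure_lt_of_integral [IsProbabilityMeasure P] {W : ℕ → Ω → ℝ} {w : ℕ → ℝ}
    {c : ℝ} (hc : 0 < c) (hW : ∀ n ω, 0 ≤ W n ω) (hi : ∀ n, Integrable (W n) P)
    (hw : ∀ᶠ n in atTop, 0 < w n)
    (hlim : Tendsto (fun n => (∫ ω, W n ω ∂P) / w n) atTop (𝓝 0)) :
    Tendsto (fun n => P {ω | c * w n < W n ω}) atTop (𝓝 0) := by
  have h1 : Tendsto (fun n => P.real {ω | c * w n < W n ω}) atTop (𝓝 0) := by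
    have h2 := hlim.const_mul c⁻¹
    rw [mul_zero] at h2
    refine squeeze_zero' (Eventually.of_forall fun n => measureReal_nonneg) ?_ h2
    filter_upwards [hw] with n hn
    have h3 := mul_meas_ge_le_integral_of_nonneg (ae_of_all P (hW n)) (hi n) (c * w n)
    have h4 : P.real {ω | c * w n < W n ω} ≤ P.real {ω | c * w n ≤ W n ω} :=
      measureReal_mono fun ω (hω : c * w n < W n ω) => hω.le
    rw [inv_mul_eq_div, div_div, le_div_iff₀ (by positivity)]
    nlinarith [mul_pos hc hn]
  have h2 := ENNReal.tendsto_ofReal h1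
  rw [ENNReal.ofReal_zero] at h2
  exact h2.congr fun n => ofReal_measureReal

variable {H : Type*} [NormedAddCommGroup H] [InnerProductSpace ℝ H] [MeasurableSpace H]
  [CompleteSpace H] [BorelSpace H] [SecondCountableTopology H]

namespace ShortMemory

variable {F : Set ℤ → MeasurableSpace Ω} {x : ℤ → Ω → H} {y : ℕ → ℤ → Ω → H} {M : ℝ} {δ : ℕ → ℝ}
  [IsProbabilityMeasure P] (hs : ShortMemory P F x y M δ) {K : ℝ → ℝ} (hK : IsKernel K)
  {h : ℕ → ℝ} (hh : IsBandwidth h) (hC : Summable fun r : ℤ => ‖autoCov P x r‖)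
include hs hK hh hC

/-- The kernel estimator computed from the errors themselves is consistent. -/
theorem isLittleOP_kernelEstimator_sub :
    IsLittleOP P (fun n ω => ‖kernelEstimator K (h n) n (fun i => x (i : ℤ) ω) - longRunCov P x‖)
      (fun _ => 1) := by
  intro c hc
  obtain ⟨C, b, hb, hle⟩ := hs.exists_integral_norm_lagCov_sub_le
    (hC.comp_injective Nat.cast_injective)
  set W : ℕ → Ω → ℝ := fun n ω => ∑ r ∈ Finset.Icc (-(n : ℤ)) n,
    |K (r / h n)| * ‖lagCov n (fun i => x (i : ℤ) ω) r.natAbs - autoCov P x r.natAbs‖ with hW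
  set β : ℕ → ℝ := fun n =>
    ‖∑ r ∈ Finset.Icc (-(n : ℤ)) n, K (r / h n) • autoCov P x r - longRunCov P x‖
  have hi : ∀ (n : ℕ) (r : ℤ), Integrable (fun ω => |K (r / h n)|
      * ‖lagCov n (fun i => x (i : ℤ) ω) r.natAbs - autoCov P x r.natAbs‖) P := fun n r =>
    ((hs.integrable_lagCov n r.natAbs).sub (integrable_const _)).norm.const_mul _
  have hWint : ∀ n, ∫ ω, W n ω ∂P = ∑ r ∈ Finset.Icc (-(n : ℤ)) n, |K (r / h n)|
      * ∫ ω, ‖lagCov n (fun i => x (i : ℤ) ω) r.natAbs - autoCov P x r.natAbs‖ ∂P := by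
    intro n
    simp only [hW]
    rw [integral_finsetSum _ fun r _ => hi n r]
    simp only [integral_const_mul]
  have hWlim : Tendsto (fun n => ∫ ω, W n ω ∂P) atTop (𝓝 0) := by
    simp only [hWint]
    exact tendsto_sum_abs_kernel_mul hK hh
      (fun n r => ∫ ω, ‖lagCov n (fun i => x (i : ℤ) ω) r - autoCov P x r‖ ∂P)
      (fun n r => integral_nonneg fun _ => norm_nonneg _) C b hb hle
      hs.tendsto_integral_norm_lagCov_sub
  have hβ : Tendsto β atTop (𝓝 0) := by
    have := (tendsto_sum_kernel_smul hK hh (autoCov P x) hC).sub_const (longRunCov P x)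
    rw [← longRunCov, sub_self] at this
    have h1 := this.norm
    rw [norm_zero] at h1
    exact h1
  have hpt : ∀ n ω, ‖kernelEstimator K (h n) n (fun i => x (i : ℤ) ω) - longRunCov P x‖
      ≤ W n ω + β n := by
    intro n ω
    refine (norm_sub_le_norm_sub_add_norm_sub _
      (∑ r ∈ Finset.Icc (-(n : ℤ)) n, K (r / h n) • autoCov P x r) _).trans
      (add_le_add ?_ le_rfl)
    rw [kernelEstimator, ← Finset.sum_sub_distrib]
    refine (norm_sum_le _ _).trans (le_of_eq (Finset.sum_congr rfl fun r _ => ?_))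
    rw [← smul_sub, norm_smul, hs.norm_lagCov_sub_autoCov_eq_natAbs, Real.norm_eq_abs]
  have h1 := tendsto_measure_lt_of_integral (P := P) (half_pos hc) (W := W) (w := fun _ => 1)
    (fun n ω => Finset.sum_nonneg fun r _ => by positivity)
    (fun n => integrable_finsetSum _ fun r _ => hi n r) (Eventually.of_forall fun _ => one_pos)
    (by simpa using hWlim)
  refine tendsto_of_tendsto_of_tendsto_of_le_of_le' tendsto_const_nhds h1
    (Eventually.of_forall fun _ => zero_le) ?_
  filter_upwards [hβ.eventually (gt_mem_nhds (half_pos hc))] with n hn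
  refine measure_mono fun ω hω => ?_
  simp only [Set.mem_ofPred_eq, abs_one, mul_one, abs_norm] at hω ⊢
  linarith [hpt n ω]

/-- Under a change of size `‖Δ n‖` with `√n ‖Δ n‖ → ∞`, the kernel estimator is of smaller order
than `n ‖Δ n‖²`: the deterministic signal contributes at most the number of weighted lags times
`‖Δ n‖²`. -/
theorem isLittleOP_kernelEstimator_of_signal (s : ℕ → ℕ → H) (μ : H) (Δ : ℕ → H) (B : ℝ)
    (hB : 0 ≤ B) (hs' : ∀ n, ∀ i ∈ Finset.Icc 1 n, ‖s n i - μ‖ ≤ B * ‖Δ n‖)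
    (hΔ : Tendsto (fun n : ℕ => Real.sqrt n * ‖Δ n‖) atTop atTop) :
    IsLittleOP P
      (fun n ω => ‖kernelEstimator K (h n) n (fun i => s n i + x (i : ℤ) ω)‖)
      (fun n => (n : ℝ) * ‖Δ n‖ ^ 2) := by
  intro c hc
  set L : ℕ → ℝ := fun n => ∑ r ∈ Finset.Icc (-(n : ℤ)) n, |K (r / h n)| with hL
  set a : ℕ → ℝ := fun n => (n : ℝ) * ‖Δ n‖ ^ 2 with ha
  set N : ℕ → Ω → ℝ := fun n ω => (n : ℝ)⁻¹ * ∑ i ∈ Finset.Icc 1 n, ‖x (i : ℤ) ω‖ with hN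
  set q : ℕ → ℝ := fun n => 8 * B * L n * ‖Δ n‖ with hq
  have hL0 : ∀ n, 0 ≤ L n := fun n => Finset.sum_nonneg fun _ _ => abs_nonneg _
  have hq0 : ∀ n, 0 ≤ q n := fun n => by have := hL0 n; positivity
  have hLs : Tendsto (fun n : ℕ => L n / Real.sqrt n) atTop (𝓝 0) :=
    tendsto_sum_abs_kernel_div_sqrt hK hh
  have ha_eq : ∀ n : ℕ, a n = (Real.sqrt n * ‖Δ n‖) ^ 2 := fun n => by
    rw [mul_pow, Real.sq_sqrt (Nat.cast_nonneg n)]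
  have ha_lim : Tendsto a atTop atTop := by
    exact ((tendsto_pow_atTop two_ne_zero).comp hΔ).congr fun n => (ha_eq n).symm
  have hΔpos : ∀ᶠ n : ℕ in atTop, 0 < Real.sqrt n * ‖Δ n‖ := hΔ.eventually_gt_atTop 0
  have hpt : ∀ n ω, ‖kernelEstimator K (h n) n (fun i => s n i + x (i : ℤ) ω)‖
      ≤ ‖kernelEstimator K (h n) n (fun i => x (i : ℤ) ω) - longRunCov P x‖
        + (‖longRunCov P x‖ + (L n * (4 * B ^ 2 * ‖Δ n‖ ^ 2) + q n * N n ω)) := by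
    intro n ω
    have h1 : ‖kernelEstimator K (h n) n (fun i => s n i + x (i : ℤ) ω)
        - kernelEstimator K (h n) n (fun i => x (i : ℤ) ω)‖
        ≤ L n * (4 * B ^ 2 * ‖Δ n‖ ^ 2) + q n * N n ω := by
      rw [kernelEstimator, kernelEstimator, ← Finset.sum_sub_distrib]
      calc _ ≤ ∑ r ∈ Finset.Icc (-(n : ℤ)) n, |K (r / h n)|
            * (2 * (B * ‖Δ n‖) * (2 * (B * ‖Δ n‖) + 4 * N n ω)) := by
            refine (norm_sum_le _ _).trans (Finset.sum_le_sum fun r _ => ?_)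
            rw [← smul_sub, norm_smul, Real.norm_eq_abs]
            gcongr
            exact norm_lagCov_add_sub_le n (s n) (fun i => x (i : ℤ) ω) μ _ (by positivity)
              (hs' n) r
        _ = _ := by rw [← Finset.sum_mul]; simp only [hq, hL]; ring
    have h2 := norm_add₃_le (a := kernelEstimator K (h n) n (fun i => s n i + x (i : ℤ) ω)
        - kernelEstimator K (h n) n (fun i => x (i : ℤ) ω))
      (b := kernelEstimator K (h n) n (fun i => x (i : ℤ) ω) - longRunCov P x)
      (c := longRunCov P x)
    rw [sub_add_sub_cancel, sub_add_cancel] at h2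
    linarith
  have hNi : ∀ n, Integrable (N n) P := fun n =>
    (integrable_finsetSum _ fun (i : ℕ) _ => (hs.integrable_x (i : ℤ)).norm).const_mul _
  have hN0 : ∀ n ω, 0 ≤ N n ω := fun n ω => by positivity
  have hqlim : Tendsto (fun n => (∫ ω, q n * N n ω ∂P) / a n) atTop (𝓝 0) := by
    have h1 : Tendsto (fun n : ℕ => 8 * B * M * ((L n / Real.sqrt n) / (Real.sqrt n * ‖Δ n‖)))
        atTop (𝓝 0) := by
      simpa using (hLs.div_atTop hΔ).const_mul (8 * B * M)
    refine squeeze_zero' (Eventually.of_forall fun n => div_nonneg (integral_nonneg fun ω =>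
      mul_nonneg (hq0 n) (hN0 n ω)) (by positivity)) ?_ h1
    filter_upwards [hΔpos] with n hn
    have hn1 : Real.sqrt n ≠ 0 := left_ne_zero_of_mul hn.ne'
    have hn2 : ‖Δ n‖ ≠ 0 := right_ne_zero_of_mul hn.ne'
    calc (∫ ω, q n * N n ω ∂P) / a n ≤ q n * M / a n := by
          rw [integral_const_mul]
          have := hs.integral_average_norm_le n
          have := hq0 n
          have : 0 ≤ a n := by positivity
          gcongr
      _ = _ := by
          rw [ha_eq]
          simp only [hq]
          field_simp
  have hdet : Tendsto (fun n => (1 + ‖longRunCov P x‖) / a n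
      + 4 * B ^ 2 * ((L n / Real.sqrt n) * (1 / Real.sqrt n))) atTop (𝓝 0) := by
    have h1 : Tendsto (fun n : ℕ => 1 / Real.sqrt n) atTop (𝓝 0) :=
      tendsto_const_nhds.div_atTop (Real.tendsto_sqrt_atTop.comp tendsto_natCast_atTop_atTop)
    simpa using (tendsto_const_nhds.div_atTop ha_lim).add ((hLs.mul h1).const_mul (4 * B ^ 2))
  have hA := hs.isLittleOP_kernelEstimator_sub hK hh hC 1 one_pos
  have hQ := tendsto_measure_lt_of_integral (P := P) (half_pos hc)
    (W := fun n ω => q n * N n ω) (w := a) (fun n ω => mul_nonneg (hq0 n) (hN0 n ω))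
    (fun n => (hNi n).const_mul _) (ha_lim.eventually_gt_atTop 0) hqlim
  have hsum := hA.add hQ
  rw [add_zero] at hsum
  refine tendsto_of_tendsto_of_tendsto_of_le_of_le' tendsto_const_nhds hsum
    (Eventually.of_forall fun _ => zero_le) ?_
  filter_upwards [hdet.eventually (gt_mem_nhds (half_pos hc)), hΔpos] with n hn hn'
  refine (measure_mono fun ω hω => ?_).trans (measure_union_le _ _)
  have hn1 : Real.sqrt n ≠ 0 := left_ne_zero_of_mul hn'.ne'
  have han : 0 < a n := by rw [ha_eq]; positivity
  have h3 : (1 + ‖longRunCov P x‖) + L n * (4 * B ^ 2 * ‖Δ n‖ ^ 2) < c / 2 * a n := by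
    have h4 := mul_lt_mul_of_pos_right hn han
    refine lt_of_eq_of_lt ?_ h4
    rw [add_mul, div_mul_cancel₀ _ han.ne', ha_eq]
    field_simp
  simp only [Set.mem_ofPred_eq, Set.mem_union, abs_one, mul_one, abs_norm] at hω ⊢
  rw [abs_of_pos han] at hω
  by_contra hcon
  rw [not_or, not_lt, not_lt] at hcon
  linarith [hpt n ω, hcon.1, hcon.2]

end ShortMemory

end

/-! ### Causal functions of i.i.d. innovations -/

section Causal

variable {Ω : Type*} {S : Type*} [MeasurableSpace S]

/-- The σ-algebra generated by the innovations with index in `I`. -/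
abbrev innovationSigma (η : ℤ → Ω → S) (I : Set ℤ) : MeasurableSpace Ω :=
  ⨆ i ∈ I, MeasurableSpace.comap (η i) inferInstance

/-- The sequence `η_j, η_{j-1}, …` of the innovations up to time `j`, most recent first. -/
def past (η : ℤ → Ω → S) (j : ℤ) (ω : Ω) : ℕ → S := fun k => η (j - k) ω

/-- The sequence whose first `l` entries are those of `s`, and whose other entries are those of
`s'`. -/
def splice (l : ℕ) (s s' : ℕ → S) : ℕ → S := fun k => if k < l then s k else s' k

theorem measurable_innovation (η : ℤ → Ω → S) {I : Set ℤ} {i : ℤ} (hi : i ∈ I) :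
    Measurable[innovationSigma η I] (η i) :=
  (comap_measurable (η i)).mono
    (le_iSup₂ (f := fun i (_ : i ∈ I) => MeasurableSpace.comap (η i) inferInstance) i hi) le_rfl

theorem measurable_past_innovationSigma (η : ℤ → Ω → S) (j : ℤ) :
    Measurable[innovationSigma η (Set.Iic j)] (past η j) :=
  let _ := innovationSigma η (Set.Iic j)
  measurable_pi_iff.2 fun k => measurable_innovation η (Set.mem_Iic.2 (by omega))

theorem measurable_splice_past (η : ℤ → Ω → S) (l : ℕ) (j : ℤ) (c : ℕ → S) :
    Measurable[innovationSigma η (Set.Ioc (j - l) j)] fun ω => splice l (past η j ω) c := by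
  let _ := innovationSigma η (Set.Ioc (j - l) j)
  refine measurable_pi_iff.2 fun k => ?_
  by_cases hk : k < l
  · simp only [splice, if_pos hk]
    exact measurable_innovation η (Set.mem_Ioc.2 (by omega))
  · simp only [splice, if_neg hk]
    exact measurable_const

theorem measurable_splice (l : ℕ) :
    Measurable fun p : (ℕ → S) × (ℕ → S) => splice l p.1 p.2 := by
  refine measurable_pi_iff.2 fun k => ?_
  by_cases hk : k < l
  · simp only [splice, if_pos hk]; fun_prop
  · simp only [splice, if_neg hk]; fun_prop

omit [MeasurableSpace S] in
theorem splice_splice (l : ℕ) (s c s' : ℕ → S) : splice l (splice l s c) s' = splice l s s' := by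
  funext k
  by_cases hk : k < l <;> simp [splice, hk]

/-- Splicing two independent i.i.d. sequences with the same marginal law gives a sequence with the
same law. -/
theorem map_splice_infinitePi (ρ : Measure S) [IsProbabilityMeasure ρ] (l : ℕ) :
    ((Measure.infinitePi fun _ : ℕ => ρ).prod (Measure.infinitePi fun _ : ℕ => ρ)).map
      (fun p => splice l p.1 p.2) = Measure.infinitePi fun _ : ℕ => ρ := by
  refine Measure.eq_infinitePi _ fun s t ht => ?_
  rw [Measure.map_apply (measurable_splice l) (.pi s.countable_toSet fun _ _ => ht _)]
  have e : (fun p : (ℕ → S) × (ℕ → S) => splice l p.1 p.2) ⁻¹' (Set.pi s t)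
      = (Set.pi ((s.filter (· < l) : Finset ℕ) : Set ℕ) t)
        ×ˢ (Set.pi ((s.filter (¬ · < l) : Finset ℕ) : Set ℕ) t) := by
    ext p
    simp only [Set.mem_preimage, Set.mem_pi, Set.mem_prod, Finset.mem_coe, Finset.mem_filter,
      splice]
    constructor
    · refine fun h => ⟨fun k hk => ?_, fun k hk => ?_⟩
      · simpa [hk.2] using h k hk.1
      · simpa [hk.2] using h k hk.1
    · intro h k hk
      by_cases hkl : k < l
      · simpa [hkl] using h.1 k ⟨hk, hkl⟩
      · simpa [hkl] using h.2 k ⟨hk, hkl⟩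
  rw [e, Measure.prod_prod, Measure.infinitePi_pi _ fun i _ => ht i,
    Measure.infinitePi_pi _ fun i _ => ht i, Finset.prod_filter_mul_prod_filter_not]

variable [mΩ : MeasurableSpace Ω] {P : Measure Ω}

theorem IsIID.measurable_past {η : ℤ → Ω → S} (hη : IsIID P η) (j : ℤ) : Measurable (past η j) :=
  measurable_pi_iff.2 fun k => hη.measurable (j - k)

theorem IsIID.map_past {η : ℤ → Ω → S} (hη : IsIID P η) (j : ℤ) :
    P.map (past η j) = Measure.infinitePi fun _ : ℕ => P.map (η 0) := by
  have h : iIndepFun (fun k : ℕ => η (j - k)) P :=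
    hη.indep.precomp (g := fun k : ℕ => j - (k : ℤ)) fun a b hab => by simpa using hab
  have h2 := h.map_fun_eq_infinitePi_map fun k : ℕ => hη.measurable (j - k)
  simp only [(hη.identDistrib _).map_eq] at h2
  exact h2

theorem IsIID.innovationSigma_le {η : ℤ → Ω → S} (hη : IsIID P η) (I : Set ℤ) :
    innovationSigma η I ≤ mΩ :=
  iSup₂_le fun i _ => (hη.measurable i).comap_le

theorem IsIID.indep_innovationSigma {η : ℤ → Ω → S} (hη : IsIID P η) {I J : Set ℤ}
    (hIJ : Disjoint I J) : Indep (innovationSigma η I) (innovationSigma η J) P :=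
  indep_iSup_of_disjoint (fun i => (hη.measurable i).comap_le) hη.indep hIJ

/-- Integrating out one of two independent variables does not increase the second moment. -/
theorem memLp_integral_prod_right {α β : Type*} [MeasurableSpace α] [MeasurableSpace β]
    {μ : Measure α} {ν : Measure β} [IsProbabilityMeasure μ] [IsProbabilityMeasure ν]
    {E : Type*} [NormedAddCommGroup E] [NormedSpace ℝ E] {Ψ : α × β → E}
    (hm : StronglyMeasurable Ψ) (hΨ : MemLp Ψ 2 (μ.prod ν)) :
    MemLp (fun a => ∫ b, Ψ (a, b) ∂ν) 2 μ ∧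
      ∫ a, ‖∫ b, Ψ (a, b) ∂ν‖ ^ 2 ∂μ ≤ ∫ p, ‖Ψ p‖ ^ 2 ∂(μ.prod ν) := by
  have hi : Integrable (fun p => ‖Ψ p‖ ^ 2) (μ.prod ν) := integrable_norm_sq hΨ
  have hle : ∀ᵐ a ∂μ, ‖∫ b, Ψ (a, b) ∂ν‖ ^ 2 ≤ ∫ b, ‖Ψ (a, b)‖ ^ 2 ∂ν := by
    filter_upwards [hi.prod_right_ae] with a ha
    have hL : MemLp (fun b => Ψ (a, b)) 2 ν :=
      (memLp_two_iff_integrable_sq_norm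
        (hm.comp_measurable measurable_prodMk_left).aestronglyMeasurable).2 ha
    have h0 : 0 ≤ ∫ b, ‖Ψ (a, b)‖ ^ 2 ∂ν := integral_nonneg fun _ => by positivity
    have h1 := integral_norm_le_of_sq hL (Real.sqrt_nonneg _) (Real.sq_sqrt h0).ge
    have h2 := (norm_integral_le_integral_norm _).trans h1
    calc _ ≤ (Real.sqrt (∫ b, ‖Ψ (a, b)‖ ^ 2 ∂ν)) ^ 2 := by gcongr
      _ = _ := Real.sq_sqrt h0
  have hm' : StronglyMeasurable fun a => ∫ b, Ψ (a, b) ∂ν := hm.integral_prod_right'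
  have hi' : Integrable (fun a => ∫ b, ‖Ψ (a, b)‖ ^ 2 ∂ν) μ := hi.integral_prod_left
  refine ⟨(memLp_two_iff_integrable_sq_norm hm'.aestronglyMeasurable).2
    (hi'.mono' (hm'.norm.pow 2).aestronglyMeasurable ?_), ?_⟩
  · filter_upwards [hle] with a ha
    rwa [Real.norm_of_nonneg (by positivity)]
  · rw [integral_prod _ hi]
    exact integral_mono_of_nonneg (ae_of_all _ fun _ => by positivity) hi' hle

variable {H : Type*} [NormedAddCommGroup H] [InnerProductSpace ℝ H] [CompleteSpace H]
  [MeasurableSpace H] [BorelSpace H] [SecondCountableTopology H]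

/-- The conditional expectation of `g (s)` given the first `l` entries of `s`, for an i.i.d.
sequence `s` with law `π`. -/
def truncatedMean (π : Measure (ℕ → S)) (g : (ℕ → S) → H) (l : ℕ) (s : ℕ → S) : H :=
  ∫ s', g (splice l s s') ∂π

omit [InnerProductSpace ℝ H] [CompleteSpace H] in
theorem stronglyMeasurable_splice {g : (ℕ → S) → H} (hg : Measurable g) (l : ℕ) :
    StronglyMeasurable fun p : (ℕ → S) × (ℕ → S) => g (splice l p.1 p.2) :=
  (hg.comp (measurable_splice l)).stronglyMeasurable

variable [IsProbabilityMeasure P] {η : ℤ → Ω → S} {g : (ℕ → S) → H}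

omit [IsProbabilityMeasure P] in
theorem IsIID.map_past_eq (hη : IsIID P η) (j : ℤ) : P.map (past η j) = P.map (past η 0) := by
  rw [hη.map_past, hη.map_past]

omit [IsProbabilityMeasure P] in
theorem IsIID.identDistrib_past (hη : IsIID P η) (j : ℤ) :
    IdentDistrib (past η j) (past η 0) P P :=
  ⟨(hη.measurable_past j).aemeasurable, (hη.measurable_past 0).aemeasurable, hη.map_past_eq j⟩

theorem IsIID.map_splice_past (hη : IsIID P η) (l : ℕ) :
    ((P.map (past η 0)).prod (P.map (past η 0))).map (fun p => splice l p.1 p.2)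
      = P.map (past η 0) := by
  have := Measure.isProbabilityMeasure_map (μ := P) (hη.measurable 0).aemeasurable
  rw [hη.map_past]
  exact map_splice_infinitePi _ l

theorem IsIID.map_prodMap_past (hη : IsIID P η) :
    (P.prod P).map (Prod.map (past η 0) (past η 0))
      = (P.map (past η 0)).prod (P.map (past η 0)) :=
  (Measure.map_prod_map P P (hη.measurable_past 0) (hη.measurable_past 0)).symm

omit [InnerProductSpace ℝ H] [CompleteSpace H] in
theorem IsIID.memLp_splice (hη : IsIID P η) (hg : Measurable g) (l : ℕ) {q : ENNReal}
    (h : MemLp g q (P.map (past η 0))) :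
    MemLp (fun p : (ℕ → S) × (ℕ → S) => g (splice l p.1 p.2)) q
      ((P.map (past η 0)).prod (P.map (past η 0))) := by
  rw [← hη.map_splice_past l] at h
  exact (memLp_map_measure_iff hg.aestronglyMeasurable (measurable_splice l).aemeasurable).1 h

omit [InnerProductSpace ℝ H] [CompleteSpace H] in
theorem IsIID.memLp_coupledError (hη : IsIID P η) (hg : Measurable g) (l : ℕ) {q : ENNReal}
    (h : MemLp g q (P.map (past η 0))) : MemLp (coupledError g η 0 l) q (P.prod P) := by
  have h1 := hη.memLp_splice hg l h
  rw [← hη.map_prodMap_past] at h1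
  exact (memLp_map_measure_iff (stronglyMeasurable_splice hg l).aestronglyMeasurable
    ((hη.measurable_past 0).prodMap (hη.measurable_past 0)).aemeasurable).1 h1

/-- A causal function of i.i.d. innovations has short memory, the approximations being the
conditional expectations given the most recent innovations. By Jensen's inequality their errors
are bounded by the coupling distances. -/
theorem IsIID.shortMemory (hη : IsIID P η) (hg : Measurable g)
    (hL : MemLp g 2 (P.map (past η 0))) (hg0 : ∫ s, g s ∂(P.map (past η 0)) = 0) (δ : ℕ → ℝ)
    (hδ0 : ∀ l, 0 ≤ δ l)
    (hδ : ∀ l, ∫ p, ‖g (past η 0 p.1) - coupledError g η 0 l p‖ ^ 2 ∂(P.prod P) ≤ δ l ^ 2)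
    (hsum : Summable δ) (hbdd : ∃ B, ∀ l : ℕ, l * δ l ≤ B) :
    ShortMemory P (innovationSigma η) (fun j ω => g (past η j ω))
      (fun l j ω => truncatedMean (P.map (past η 0)) g l (past η j ω))
      (Real.sqrt (∫ s, ‖g s‖ ^ 2 ∂(P.map (past η 0)))) δ := by
  set π := P.map (past η 0) with hπ
  have hπp : IsProbabilityMeasure π :=
    Measure.isProbabilityMeasure_map (hη.measurable_past 0).aemeasurable
  have hΦm := fun l => stronglyMeasurable_splice hg l
  have hΦ : ∀ l, MemLp (fun p : (ℕ → S) × (ℕ → S) => g (splice l p.1 p.2)) 2 (π.prod π) :=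
    fun l => hη.memLp_splice hg l hL
  have hG := fun l => memLp_integral_prod_right (hΦm l) (hΦ l)
  have hGm : ∀ l, StronglyMeasurable (truncatedMean π g l) := fun l => (hΦm l).integral_prod_right'
  have hD := fun l => memLp_integral_prod_right
    ((hg.stronglyMeasurable.comp_measurable measurable_fst).sub (hΦm l))
    ((hL.comp_fst π).sub (hΦ l))
  -- Laws at time `j` are those at time `0`.
  have htrans : ∀ (j : ℤ) (φ : (ℕ → S) → ℝ), StronglyMeasurable φ →
      ∫ ω, φ (past η j ω) ∂P = ∫ s, φ s ∂π := by
    intro j φ hφ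
    rw [hπ, ← hη.map_past_eq j, integral_map (hη.measurable_past j).aemeasurable
      hφ.aestronglyMeasurable]
  have hmem : ∀ (j : ℤ) (φ : (ℕ → S) → H), StronglyMeasurable φ → MemLp φ 2 π →
      MemLp (fun ω => φ (past η j ω)) 2 P := by
    intro j φ hφ h
    rw [hπ, ← hη.map_past_eq j] at h
    exact (memLp_map_measure_iff hφ.aestronglyMeasurable (hη.measurable_past j).aemeasurable).1 h
  have hsq0 : 0 ≤ ∫ s, ‖g s‖ ^ 2 ∂π := integral_nonneg fun _ => by positivity
  obtain ⟨ω₀⟩ : Nonempty Ω := nonempty_of_isProbabilityMeasure P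
  have hpast : ∀ (r : ℕ) (j : ℤ) (k : ℕ) (ω : Ω), past η (j + r) ω (k + r) = past η j ω k := by
    intro r j k ω
    simp only [past]
    congr 1
    push_cast; ring
  have hident : ∀ (φ : (ℕ → S) → H), Measurable φ → ∀ (r : ℕ) (j : ℤ),
      IdentDistrib (fun ω => (φ (past η j ω), φ (past η (j + r) ω)))
        (fun ω => (φ (past η 0 ω), φ (past η r ω))) P P := by
    intro φ hφ r j
    have hψ : Measurable fun s : ℕ → S => (φ fun k => s (k + r), φ s) :=
      (hφ.comp (measurable_pi_lambda _ fun k => measurable_pi_apply (k + r))).prodMk hφ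
    have h := ((hη.identDistrib_past (j + r)).trans (hη.identDistrib_past (0 + r)).symm).comp hψ
    have e : ∀ j' : ℤ, ((fun s : ℕ → S => (φ fun k => s (k + r), φ s)) ∘ past η (j' + r))
        = fun ω => (φ (past η j' ω), φ (past η (j' + r) ω)) := by
      intro j'
      funext ω
      simp only [Function.comp_apply, hpast]
    rw [e, e] at h
    simpa only [zero_add] using h
  refine
    { le := hη.innovationSigma_le
      mono := fun I J hIJ => biSup_mono hIJ
      indep := fun I J hIJ => hη.indep_innovationSigma hIJ
      measurable_x := fun j => hg.comp (measurable_past_innovationSigma η j)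
      measurable_y := fun l j => ?_
      memLp_x := fun j => hmem j g hg.stronglyMeasurable hL
      memLp_y := fun l j => hmem j _ (hGm l) (hG l).1
      nonneg := Real.sqrt_nonneg _
      sq_x := fun j => ?_
      sq_y := fun l j => ?_
      mean_y := fun l j => ?_
      err_nonneg := hδ0
      err := fun l j => ?_
      summable := hsum
      bounded := hbdd
      identDistrib_x := hident g hg
      identDistrib_y := fun l => hident _ (hGm l).measurable }
  · have e : ∀ ω, truncatedMean π g l (past η j ω)
        = truncatedMean π g l (splice l (past η j ω) (past η 0 ω₀)) := fun ω => by
      simp only [truncatedMean, splice_splice]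
    simp only [e]
    exact (hGm l).measurable.comp (measurable_splice_past η l j _)
  · rw [Real.sq_sqrt hsq0, htrans j (fun s => ‖g s‖ ^ 2) (hg.stronglyMeasurable.norm.pow 2)]
  · rw [Real.sq_sqrt hsq0, htrans j (fun s => ‖truncatedMean π g l s‖ ^ 2) ((hGm l).norm.pow 2)]
    refine (hG l).2.trans (le_of_eq ?_)
    conv_rhs => rw [hπ, ← hη.map_splice_past l]
    rw [integral_map (f := fun s => ‖g s‖ ^ 2) (measurable_splice l).aemeasurable
      (hg.stronglyMeasurable.norm.pow 2).aestronglyMeasurable]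
  · have h1 : ∫ ω, truncatedMean π g l (past η j ω) ∂P = ∫ s, truncatedMean π g l s ∂π := by
      rw [hπ, ← hη.map_past_eq j, integral_map (hη.measurable_past j).aemeasurable,
        hη.map_past_eq j]
      rw [hη.map_past_eq j]
      exact (hGm l).aestronglyMeasurable
    have h2 : ∫ s, truncatedMean π g l s ∂π = ∫ p, g (splice l p.1 p.2) ∂(π.prod π) :=
      (integral_prod _ ((hΦ l).integrable one_le_two)).symm
    rw [h1, h2, ← hg0]
    conv_rhs => rw [hπ, ← hη.map_splice_past l]
    rw [integral_map (measurable_splice l).aemeasurable hg.aestronglyMeasurable]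
  · rw [htrans j (fun s => ‖g s - truncatedMean π g l s‖ ^ 2)
      ((hg.stronglyMeasurable.sub (hGm l)).norm.pow 2)]
    have h1 : ∫ s, ‖g s - truncatedMean π g l s‖ ^ 2 ∂π
        = ∫ s, ‖∫ s', (g s - g (splice l s s')) ∂π‖ ^ 2 ∂π := by
      refine integral_congr_ae ?_
      filter_upwards [((hΦ l).integrable one_le_two).prod_right_ae] with s hs
      rw [integral_sub (integrable_const _) hs, integral_const, probReal_univ, one_smul]
      rfl
    rw [h1]
    refine (hD l).2.trans (le_trans (le_of_eq ?_) (hδ l))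
    rw [hπ, ← hη.map_prodMap_past, integral_map
      ((hη.measurable_past 0).prodMap (hη.measurable_past 0)).aemeasurable]
    · rfl
    · exact (((hg.stronglyMeasurable.comp_measurable measurable_fst).sub
        (hΦm l)).norm.pow 2).aestronglyMeasurable

end Causal

/-! ### Decomposable errors -/

/-- Lyapunov's inequality between the moments of orders `2` and `q`. -/
theorem integral_norm_sq_rpow_le {E : Type*} [NormedAddCommGroup E]
    {α : Type*} [MeasurableSpace α] {μ : Measure α}
    [IsProbabilityMeasure μ] {X : α → E} {q : ℝ} (hq : 2 ≤ q)
    (hX : MemLp X (ENNReal.ofReal q) μ) :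
    (∫ a, ‖X a‖ ^ (2 : ℝ) ∂μ) ^ (1 / 2 : ℝ) ≤ (∫ a, ‖X a‖ ^ q ∂μ) ^ (1 / q) := by
  have hq0 : 0 < q := by linarith
  have h2q : (2 : ENNReal) ≤ ENNReal.ofReal q := by
    rw [← ENNReal.ofReal_ofNat 2]; exact ENNReal.ofReal_le_ofReal hq
  have h := eLpNorm_le_eLpNorm_of_exponent_le h2q hX.1
  rw [(hX.mono_exponent h2q).eLpNorm_eq_integral_rpow_norm two_ne_zero ENNReal.ofNat_ne_top,
    hX.eLpNorm_eq_integral_rpow_norm (by simpa using hq0) ENNReal.ofReal_ne_top,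
    ENNReal.ofReal_le_ofReal_iff (Real.rpow_nonneg (integral_nonneg fun _ => by positivity) _),
    ENNReal.toReal_ofReal hq0.le, ENNReal.toReal_ofNat] at h
  simpa only [one_div] using h

section Decomposable

variable {Ω : Type*} [MeasurableSpace Ω] {P : Measure Ω} [IsProbabilityMeasure P]
  {S : Type*} [MeasurableSpace S]
  {H : Type*} [NormedAddCommGroup H] [InnerProductSpace ℝ H] [MeasurableSpace H]
  [BorelSpace H] [SecondCountableTopology H]
  {ε : ℤ → Ω → H} {g : (ℕ → S) → H} {η : ℤ → Ω → S} {m κ : ℝ}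

namespace LmDecomposable

variable (hd : LmDecomposable P ε g η m κ)
include hd

omit [IsProbabilityMeasure P] [InnerProductSpace ℝ H] in
theorem memLp_past : MemLp g (ENNReal.ofReal m) (P.map (past η 0)) := by
  rw [memLp_map_measure_iff hd.measurable.aestronglyMeasurable
    (hd.iid.measurable_past 0).aemeasurable]
  exact (memLp_congr_ae (hd.eq_shift 0)).1 hd.moment

omit [IsProbabilityMeasure P] [InnerProductSpace ℝ H] [BorelSpace H]
  [SecondCountableTopology H] in
theorem couplingMoment_eq (q : ℝ) (l : ℕ) : couplingMoment P ε g η q l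
    = ∫ p, ‖g (past η 0 p.1) - coupledError g η 0 l p‖ ^ q ∂(P.prod P) := by
  refine integral_congr_ae ?_
  filter_upwards [Measure.quasiMeasurePreserving_fst.ae (hd.eq_shift 0)] with p hp
  rw [hp]
  rfl

omit [InnerProductSpace ℝ H] in
theorem memLp_sub_coupledError (l : ℕ) :
    MemLp (fun p : Ω × Ω => g (past η 0 p.1) - coupledError g η 0 l p) (ENNReal.ofReal m)
      (P.prod P) :=
  MemLp.sub (((memLp_congr_ae (hd.eq_shift 0)).1 hd.moment).comp_fst P)
    (hd.iid.memLp_coupledError hd.measurable l hd.memLp_past)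

omit [InnerProductSpace ℝ H] in
/-- The coupling distances in mean square are summable. This uses `m < κ`: the distance in mean
of order `m` is a power larger than one of the summable sequence in the hypothesis. -/
theorem summable_couplingMoment_two :
    Summable fun l => couplingMoment P ε g η 2 l ^ (1 / 2 : ℝ) := by
  have hm0 : 0 < m := by linarith [hd.two_lt]
  have hκ0 : 0 < κ := hm0.trans hd.lt
  have hnn : ∀ q l, 0 ≤ couplingMoment P ε g η q l := fun q l =>
    integral_nonneg fun _ => by positivity
  refine Summable.of_norm_bounded_eventually_nat hd.summable ?_
  filter_upwards [hd.summable.tendsto_atTop_zero.eventually (gt_mem_nhds one_pos)] with l hl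
  set a := couplingMoment P ε g η m l ^ (1 / κ) with ha
  have ha0 : 0 ≤ a := Real.rpow_nonneg (hnn m l) _
  rw [Real.norm_of_nonneg (Real.rpow_nonneg (hnn 2 l) _)]
  calc couplingMoment P ε g η 2 l ^ (1 / 2 : ℝ)
      ≤ couplingMoment P ε g η m l ^ (1 / m) := by
        rw [hd.couplingMoment_eq, hd.couplingMoment_eq]
        exact integral_norm_sq_rpow_le hd.two_lt.le (hd.memLp_sub_coupledError l)
    _ = a ^ (κ / m) := by
        rw [ha, ← Real.rpow_mul (hnn m l)]
        congr 1
        field_simp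
    _ ≤ a ^ (1 : ℝ) := by
        rcases ha0.eq_or_lt with h0 | h0
        · rw [← h0, Real.zero_rpow (by positivity), Real.zero_rpow one_ne_zero]
        · exact Real.rpow_le_rpow_of_exponent_ge h0 hl.le ((one_le_div hm0).2 hd.lt.le)
    _ = a := Real.rpow_one a

theorem shortMemory [CompleteSpace H] (hcen : ∫ ω, ε 0 ω ∂P = 0)
    (hbdd : ∃ B, ∀ l : ℕ, l * couplingMoment P ε g η 2 l ^ (1 / 2 : ℝ) ≤ B) :
    ShortMemory P (innovationSigma η) (fun j ω => g (past η j ω))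
      (fun l j ω => truncatedMean (P.map (past η 0)) g l (past η j ω))
      (Real.sqrt (∫ s, ‖g s‖ ^ 2 ∂(P.map (past η 0))))
      (fun l => couplingMoment P ε g η 2 l ^ (1 / 2 : ℝ)) := by
  have := Measure.isProbabilityMeasure_map (μ := P) (hd.iid.measurable_past 0).aemeasurable
  have hnn : ∀ l, 0 ≤ couplingMoment P ε g η 2 l := fun l =>
    integral_nonneg fun _ => by positivity
  have h2m : (2 : ENNReal) ≤ ENNReal.ofReal m := by
    rw [← ENNReal.ofReal_ofNat 2]; exact ENNReal.ofReal_le_ofReal hd.two_lt.le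
  refine hd.iid.shortMemory hd.measurable (hd.memLp_past.mono_exponent h2m) ?_ _
    (fun l => Real.rpow_nonneg (hnn l) _) (fun l => ?_) hd.summable_couplingMoment_two hbdd
  · rw [integral_map (hd.iid.measurable_past 0).aemeasurable
      hd.measurable.aestronglyMeasurable, ← hcen]
    exact (integral_congr_ae (hd.eq_shift 0)).symm
  · rw [← Real.sqrt_eq_rpow, Real.sq_sqrt (hnn l), hd.couplingMoment_eq]
    simp only [Real.rpow_two, le_refl]

omit [IsProbabilityMeasure P] [BorelSpace H] [SecondCountableTopology H] in
theorem autoCov_eq (r : ℤ) : autoCov P (fun j ω => g (past η j ω)) r = autoCov P ε r := by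
  refine integral_congr_ae ?_
  filter_upwards [hd.eq_shift 0, hd.eq_shift r] with ω h0 hr
  rw [h0, hr]
  rfl

end LmDecomposable

end Decomposable

theorem IsLittleOP.congr_ae {Ω : Type*} [MeasurableSpace Ω] {P : Measure Ω}
    {Z Z' : ℕ → Ω → ℝ} {a : ℕ → ℝ} (hZ : IsLittleOP P Z a) (h : ∀ᵐ ω ∂P, ∀ n, Z n ω = Z' n ω) :
    IsLittleOP P Z' a := by
  intro c hc
  refine (hZ c hc).congr fun n => measure_congr (Filter.eventuallyEq_set.2 ?_)
  filter_upwards [h] with ω hω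
  simp only [hω n]

theorem kernelEstimator_add_eq_of_null {H : Type*} [NormedAddCommGroup H] [InnerProductSpace ℝ H]
    [CompleteSpace H] (K : ℝ → ℝ) (b : ℝ) (n : ℕ) (s u : ℕ → H) (hs : NullHypothesis n s) :
    kernelEstimator K b n (fun i => s i + u i) = kernelEstimator K b n u := by
  refine Finset.sum_congr rfl fun r _ => ?_
  have h := norm_lagCov_add_sub_le n s u (s 1) 0 le_rfl (fun i hi => by
    rw [hs i hi 1 (Finset.mem_Icc.2 ⟨le_rfl, by simp only [Finset.mem_Icc] at hi; omega⟩)]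
    simp) r
  rw [mul_zero, zero_mul, norm_le_zero_iff, sub_eq_zero] at h
  rw [h]

end FunctionalChange

end

theorem mainTheorem9
    {𝒵 : Type*} [MeasurableSpace 𝒵] (ν : Measure 𝒵) [SigmaFinite ν]
    [TopologicalSpace.SeparableSpace (Lp ℝ 2 ν)]
    [MeasurableSpace (Lp ℝ 2 ν)] [BorelSpace (Lp ℝ 2 ν)]
    {Ω : Type*} [MeasurableSpace Ω] (P : Measure Ω) [IsProbabilityMeasure P]
    {S : Type*} [MeasurableSpace S]
    (K : ℝ → ℝ) (hK : FunctionalChange.IsKernel K)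
    (h : ℕ → ℝ) (hh : FunctionalChange.IsBandwidth h)
    (ε : ℤ → Ω → Lp ℝ 2 ν) (hε : FunctionalChange.ErrorAssumption P ε)
    (η : ℤ → Ω → S) (f : (ℕ → S) → Lp ℝ 2 ν) (m κ : ℝ)
    (hdec : FunctionalChange.LmDecomposable P ε f η m κ)
    (hlim : Tendsto
      (fun l : ℕ => (l : ℝ) * FunctionalChange.couplingMoment P ε f η 2 l ^ (1 / 2 : ℝ))
      atTop (𝓝 0)) :
    (∀ mean : ℕ → ℕ → Lp ℝ 2 ν, (∀ n, FunctionalChange.NullHypothesis n (mean n)) →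
      FunctionalChange.IsLittleOP P
        (fun n ω =>
          ‖FunctionalChange.kernelEstimator K (h n) n
              (FunctionalChange.observation (mean n) ε ω)
            - FunctionalChange.longRunCov P ε‖)
        (fun _ => 1)) ∧
    (∀ (μ : Lp ℝ 2 ν) (Δ : ℕ → Lp ℝ 2 ν) (g : ℝ → ℝ), FunctionalChange.IsChangeFunction g →
      Tendsto (fun n : ℕ => Real.sqrt n * ‖Δ n‖) atTop atTop →
      FunctionalChange.IsLittleOP P
        (fun n ω =>
          ‖FunctionalChange.kernelEstimator K (h n) n
              (FunctionalChange.observation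
                (FunctionalChange.alternativeMean μ (Δ n) g n) ε ω)‖)
        (fun n => (n : ℝ) * ‖Δ n‖ ^ 2)) := by

  have hsec : SecondCountableTopology (Lp ℝ 2 ν) := UniformSpace.secondCountable_of_separable _
  obtain ⟨B₀, hB₀⟩ := hlim.bddAbove_range
  have hs := hdec.shortMemory (hε.centered 0) ⟨B₀, fun l => hB₀ ⟨l, rfl⟩⟩
  have hx : ∀ᵐ ω ∂P, ∀ j : ℤ, ε j ω = f (FunctionalChange.past η j ω) :=
    ae_all_iff.2 fun j => hdec.eq_shift j
  have hC : Summable fun r : ℤ =>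
      ‖FunctionalChange.autoCov P (fun j ω => f (FunctionalChange.past η j ω)) r‖ := by
    simpa only [hdec.autoCov_eq] using hε.summable_autoCov
  have hlr : FunctionalChange.longRunCov P (fun j ω => f (FunctionalChange.past η j ω))
      = FunctionalChange.longRunCov P ε := by
    simp only [FunctionalChange.longRunCov, hdec.autoCov_eq]
  refine ⟨fun mean hmean => ?_, fun μ Δ g hg hΔ => ?_⟩
  · refine (hs.isLittleOP_kernelEstimator_sub hK hh hC).congr_ae ?_
    filter_upwards [hx] with ω hω n
    have e : FunctionalChange.observation (mean n) ε ω
        = fun i : ℕ => mean n i + f (FunctionalChange.past η i ω) := by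
      funext i
      rw [FunctionalChange.observation, hω]
    rw [hlr, e, FunctionalChange.kernelEstimator_add_eq_of_null _ _ _ _ _ (hmean n)]
  · obtain ⟨B, hB⟩ := hg.bounded
    have hB0 : 0 ≤ B := (abs_nonneg _).trans (hB 0 ⟨le_rfl, zero_le_one⟩)
    refine (hs.isLittleOP_kernelEstimator_of_signal hK hh hC
      (fun n => FunctionalChange.alternativeMean μ (Δ n) g n) μ Δ B hB0 (fun n i hi => ?_)
      hΔ).congr_ae ?_
    · rw [Finset.mem_Icc] at hi
      rw [FunctionalChange.alternativeMean, add_sub_cancel_left, norm_smul, Real.norm_eq_abs]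
      refine mul_le_mul_of_nonneg_right (hB _ ⟨by positivity, ?_⟩) (norm_nonneg _)
      have : (i : ℝ) ≤ n := by exact_mod_cast hi.2
      exact div_le_one_of_le₀ this (by positivity)
    · filter_upwards [hx] with ω hω n
      congr 2
      funext i
      rw [FunctionalChange.observation, hω]
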